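/- Theorem 1. Polygons are taken on the square lattice $\mathbb Z^2$, up to translation. A column-convex polygon $P$ of width $m\ge 1$ is a self-avoiding polygon that consists of two paths, the top path $\overline\gamma$ and the bottom path $\underline\gamma$, which use only north, south and east unit steps, have $m$ east steps each, and both go from the lowest point of the polygon on its leftmost vertical line (abscissa $0$) to the highest point of the polygon on its rightmost vertical line (abscissa $m$); the paths are self-avoiding and meet only at their two end points. For $0\le i\le m$ let $\overline N_i,\overline S_i$ (resp. $\underline N_i,\underline S_i$) be the numbers of north and south steps of the top (resp. bottom) path at abscissa $i$; in particular $\underline N_0=\underline S_0=\overline S_0=\overline N_m=\overline S_m=\underline S_m=0$. Such a polygon is convex if its perimeter equals that of its minimal bounding rectangle $R$. Let $\mathcal P$ be one of the following classes: - Ferrers graphs: convex polygons containing the south-west, south-east and north-east corners of $R$; - stacks: convex polygons containing the south-east and north-east corners of $R$; - staircase polygons: convex polygons containing the south-west and north-east corners of $R$; - bar-graphs: column-convex polygons containing the bottom edge of $R$; - all column-convex polygons. For $m\ge1$ let $\mathcal P_m$ be the set of polygons of width $m$ in $\mathcal P$, and let $$F_m(\overline{\boldsymbol y},\overline{\boldsymbol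 z},\underline{\boldsymbol y},\underline{\boldsymbol z})=\sum_{P\in\mathcal P_m}\ \prod_{i=0}^m \overline y_i^{\,\overline N_i}\,\overline z_i^{\,\overline S_i}\,\underline y_i^{\,\underline N_i}\,\underline z_i^{\,\underline S_i}.$$ This is a well-defined formal power series (only finitely many polygons contribute to each monomial), it is the expansion of a rational function with real coefficients, and this rational function is self-reciprocal: substituting for every variable its inverse multiplies it by $\pm$ a Laurent monomial. More precisely, $$F_m(1/\overline{\boldsymbol y},1/\overline{\boldsymbol z},1/\underline{\boldsymbol y},1/\underline{\boldsymbol z})=C_m\,F_m(\overline{\boldsymbol y},\overline{\boldsymbol z},\underline{\boldsymbol y},\underline{\boldsymbol z}),$$ where $$C_m=\begin{cases} \dfrac{(-1)^m\,\underline y_m^{\,m-2}}{\overline y_0}\displaystyle\prod_{i=1}^{m-1}\overline y_i & \text{for Ferrers graphs},\\[2ex] -\dfrac{\underline y_m^{\,2m-3}}{\overline y_0}\displaystyle\prod_{i=1}^{m-1}\overline y_i\,\underline z_i & \text{for stacks},\\[2ex] -\displaystyle\prod_{i=1}^{m-1}\underline y_i\,\overline y_i & \text{for staircase polygons, when } m\ge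 2,\\[2ex] \dfrac{(-1)^m}{\overline y_0\,\underline y_m} & \text{for bar-graphs},\\[2ex] -\dfrac{1}{\overline y_0\,\underline y_m} & \text{for column-convex polygons}. \end{cases}$$ -/

import Mathlib

/-! ### Lattice paths -/

/-- Unit steps of a partially directed path: north, south, east (there is no west step). -/
inductive LatticeStep
  | N
  | S
  | E
  deriving DecidableEq

/-- The displacement of a step. -/
def LatticeStep.vec : LatticeStep → ℤ × ℤ
  | .N => (0, 1)
  | .S => (0, -1)
  | .E => (1, 0)

/-- The lattice sites visited, in order, by the path that starts at `p` and makes the given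
steps. -/
def pathSites : ℤ × ℤ → List LatticeStep → List (ℤ × ℤ)
  | p, [] => [p]
  | p, s :: l => p :: pathSites (p + s.vec) l

/-- The site at which the path ends. -/
def pathEnd : ℤ × ℤ → List LatticeStep → ℤ × ℤ
  | p, [] => p
  | p, s :: l => pathEnd (p + s.vec) l

/-- The steps of the path, each one together with the site from which it is made. -/
def pathSteps : ℤ × ℤ → List LatticeStep → List ((ℤ × ℤ) × LatticeStep)
  | _, [] => []
  | p, s :: l => (p, s) :: pathSteps (p + s.vec) l

/-- The number of steps of type `s` made at abscissa `i` by the path that starts at the origin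
and makes the steps `l`. -/
def stepsAt (l : List LatticeStep) (s : LatticeStep) (i : ℕ) : ℕ :=
  (pathSteps (0, 0) l).countP (fun a => a.1.1 = (i : ℤ) ∧ a.2 = s)

theorem pathSites_ne_nil (p : ℤ × ℤ) (l : List LatticeStep) : pathSites p l ≠ [] := by
  cases l <;> simp [pathSites]

/-! ### Column-convex polygons -/

/-- A column-convex polygon of width `m`, up to translation: two partially directed paths, the
top path and the bottom path, with the same end points, which together form a self-avoiding
polygon. The translation is fixed by letting both paths start at the origin. The end points are
the lowest point of the leftmost vertical line and the highest point of the rightmost vertical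
line of the polygon. -/
@[ext]
structure ColumnConvexPolygon (m : ℕ) where
  /-- the steps of the top path -/
  top : List LatticeStep
  /-- the steps of the bottom path -/
  bot : List LatticeStep
  /-- the paths have the same end point -/
  end_eq : pathEnd (0, 0) top = pathEnd (0, 0) bot
  /-- the polygon has width `m` -/
  width_eq : (pathEnd (0, 0) top).1 = (m : ℤ)
  /-- the top path is self-avoiding -/
  top_nodup : (pathSites (0, 0) top).Nodup
  /-- the bottom path is self-avoiding -/
  bot_nodup : (pathSites (0, 0) bot).Nodup
  /-- the two paths meet at their end points only -/
  meet : ∀ v ∈ pathSites (0, 0) top, v ∈ pathSites (0, 0) bot →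
    v = (0, 0) ∨ v = pathEnd (0, 0) top
  /-- the polygon is not a single edge run through back and forth -/
  top_ne_bot : top ≠ bot
  /-- the choice of the left end point -/
  top_S_zero : stepsAt top .S 0 = 0
  bot_N_zero : stepsAt bot .N 0 = 0
  bot_S_zero : stepsAt bot .S 0 = 0
  /-- the choice of the right end point -/
  top_N_last : stepsAt top .N m = 0
  top_S_last : stepsAt top .S m = 0
  bot_S_last : stepsAt bot .S m = 0

namespace ColumnConvexPolygon

variable {m : ℕ}

/-- The lattice sites on the polygon. -/
def sites (P : ColumnConvexPolygon m) : Finset (ℤ × ℤ) :=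
  (pathSites (0, 0) P.top ++ pathSites (0, 0) P.bot).toFinset

theorem sites_nonempty (P : ColumnConvexPolygon m) : P.sites.Nonempty := by
  obtain ⟨v, hv⟩ := List.exists_mem_of_ne_nil _ (pathSites_ne_nil (0, 0) P.top)
  exact ⟨v, by simp [sites, hv]⟩

/-- The perimeter of the polygon: the number of its steps. -/
def perimeter (P : ColumnConvexPolygon m) : ℕ := P.top.length + P.bot.length

/-- The ordinate of the bottom edge of the minimal bounding rectangle. (Horizontally this
rectangle extends from abscissa `0` to abscissa `m`.) -/
def yMin (P : ColumnConvexPolygon m) : ℤ := P.sites.inf' P.sites_nonempty Prod.snd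

/-- The ordinate of the top edge of the minimal bounding rectangle. -/
def yMax (P : ColumnConvexPolygon m) : ℤ := P.sites.sup' P.sites_nonempty Prod.snd

/-- A polygon is convex if its perimeter equals that of its minimal bounding rectangle. -/
def IsConvex (P : ColumnConvexPolygon m) : Prop :=
  (P.perimeter : ℤ) = 2 * ((m : ℤ) + (P.yMax - P.yMin))

/-- The polygon contains the south-west corner of its minimal bounding rectangle. -/
def HasSW (P : ColumnConvexPolygon m) : Prop := ((0 : ℤ), P.yMin) ∈ P.sites

/-- The polygon contains the south-east corner of its minimal bounding rectangle. -/
def HasSE (P : ColumnConvexPolygon m) : Prop := ((m : ℤ), P.yMin) ∈ P.sites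

/-- The polygon contains the north-east corner of its minimal bounding rectangle. -/
def HasNE (P : ColumnConvexPolygon m) : Prop := ((m : ℤ), P.yMax) ∈ P.sites

/-- The polygon contains (every unit edge of) the bottom edge of its minimal bounding
rectangle. -/
def HasBottomEdge (P : ColumnConvexPolygon m) : Prop :=
  ∀ x : ℤ, 0 ≤ x → x < m →
    ((x, P.yMin), LatticeStep.E) ∈ pathSteps (0, 0) P.top ++ pathSteps (0, 0) P.bot

end ColumnConvexPolygon

/-- The classes of polygons. -/
inductive PolygonClass
  | ferrers
  | stack
  | staircase
  | barGraph
  | columnConvex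

/-- Membership of a polygon in a class. Ferrers graphs contain the south-west, south-east and
north-east corners of the minimal bounding rectangle, stacks the south-east and north-east ones,
staircase polygons the south-west and north-east ones. -/
def PolygonClass.Mem {m : ℕ} : PolygonClass → ColumnConvexPolygon m → Prop
  | .ferrers, P => P.IsConvex ∧ P.HasSW ∧ P.HasSE ∧ P.HasNE
  | .stack, P => P.IsConvex ∧ P.HasSE ∧ P.HasNE
  | .staircase, P => P.IsConvex ∧ P.HasSW ∧ P.HasNE
  | .barGraph, P => P.HasBottomEdge
  | .columnConvex, _ => True

/-! ### Rational functions and self-reciprocity -/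

noncomputable section

/-- Rational functions with real coefficients in the variables `σ`. -/
abbrev RationalFun (σ : Type*) : Type _ := FractionRing (MvPolynomial σ ℝ)

namespace RationalFun

variable {σ : Type*}

/-- A variable, as a rational function. -/
def var (i : σ) : RationalFun σ :=
  algebraMap (MvPolynomial σ ℝ) (RationalFun σ) (MvPolynomial.X i)

theorem var_ne_zero (i : σ) : var i ≠ 0 := by
  simp [var]

/-- The substitution of `1 / y_i` for every variable `y_i` in a polynomial. -/
def polyInv (σ : Type*) : MvPolynomial σ ℝ →ₐ[ℝ] RationalFun σ :=
  MvPolynomial.aeval fun i => (var i)⁻¹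

theorem monomial_mul_polyInv (p : MvPolynomial σ ℝ) (n : σ →₀ ℕ) (hn : ∀ d ∈ p.support, d ≤ n) :
    algebraMap (MvPolynomial σ ℝ) (RationalFun σ) (MvPolynomial.monomial n 1) * polyInv σ p =
      algebraMap (MvPolynomial σ ℝ) (RationalFun σ)
        (∑ d ∈ p.support, MvPolynomial.monomial (n - d) (p.coeff d)) := by
  have key : ∀ (d : σ →₀ ℕ) (c : ℝ), polyInv σ (MvPolynomial.monomial d c) =
      algebraMap (MvPolynomial σ ℝ) (RationalFun σ) (MvPolynomial.C c) *
        (algebraMap (MvPolynomial σ ℝ) (RationalFun σ) (MvPolynomial.monomial d 1))⁻¹ := by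
    intro d c
    rw [polyInv, MvPolynomial.aeval_monomial, MvPolynomial.monomial_eq, MvPolynomial.C_1, one_mul]
    congr 1
    simp only [Finsupp.prod, var, map_prod, map_pow, inv_pow, Finset.prod_inv_distrib]
  conv_lhs => rw [p.as_sum]
  rw [map_sum, map_sum, Finset.mul_sum]
  refine Finset.sum_congr rfl fun d hd => ?_
  have h1 : (MvPolynomial.monomial n (1 : ℝ)) =
      MvPolynomial.monomial (n - d) 1 * MvPolynomial.monomial d 1 := by
    rw [MvPolynomial.monomial_mul, one_mul, tsub_add_cancel_of_le (hn d hd)]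
  have h2 : MvPolynomial.monomial (n - d) (p.coeff d) =
      MvPolynomial.C (p.coeff d) * MvPolynomial.monomial (n - d) 1 := by
    rw [MvPolynomial.C_mul_monomial, mul_one]
  have h3 : algebraMap (MvPolynomial σ ℝ) (RationalFun σ) (MvPolynomial.monomial d 1) ≠ 0 := by
    simp
  rw [key, h1, h2, map_mul, map_mul]
  field_simp

theorem polyInv_injective (σ : Type*) : Function.Injective (polyInv σ) := by
  classical
  rw [injective_iff_map_eq_zero]
  intro p hp
  have hn : ∀ d ∈ p.support, d ≤ ∑ d ∈ p.support, d := fun d hd =>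
    Finset.single_le_sum_of_canonicallyOrdered (f := id) hd
  have h := monomial_mul_polyInv p _ hn
  rw [hp, mul_zero, eq_comm, map_eq_zero_iff _ (IsFractionRing.injective _ _)] at h
  by_contra hp0
  obtain ⟨d₀, hd₀⟩ := Finset.nonempty_iff_ne_empty.mpr
    (fun he => hp0 (MvPolynomial.support_eq_empty.mp he))
  have h0 := congrArg (MvPolynomial.coeff ((∑ d ∈ p.support, d) - d₀)) h
  rw [MvPolynomial.coeff_sum, Finset.sum_eq_single d₀] at h0
  · simp at h0
    exact (MvPolynomial.mem_support_iff.mp hd₀) h0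
  · intro d hd hne
    rw [MvPolynomial.coeff_monomial, if_neg]
    intro he
    apply hne
    have := congrArg (fun t => (∑ d ∈ p.support, d) - t) he
    simpa [tsub_tsub_cancel_of_le (hn d hd), tsub_tsub_cancel_of_le (hn d₀ hd₀)] using this
  · exact fun h' => absurd hd₀ h'

/-- The substitution `f(y) ↦ f(1/y)` on rational functions. -/
def recip : RationalFun σ →ₐ[ℝ] RationalFun σ :=
  IsFractionRing.liftAlgHom (polyInv_injective σ)

/-- `f` is self-reciprocal: `f(1/y) = ± y^β f(y)` for some integer exponents `β`. -/
def IsSelfReciprocal (f : RationalFun σ) : Prop :=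
  ∃ (ε : ℤˣ) (β : σ →₀ ℤ),
    recip f = ((ε : ℤ) : RationalFun σ) * (β.prod fun i b => var i ^ b) * f

/-- The formal power series `F` is (the expansion of) the rational function `f`. -/
def IsExpansion (F : MvPowerSeries σ ℝ) (f : RationalFun σ) : Prop :=
  ∃ p q : MvPolynomial σ ℝ, q ≠ 0 ∧
    f = algebraMap (MvPolynomial σ ℝ) (RationalFun σ) p /
        algebraMap (MvPolynomial σ ℝ) (RationalFun σ) q ∧
    (q : MvPowerSeries σ ℝ) * F = (p : MvPowerSeries σ ℝ)

end RationalFun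

/-! ### The generating functions -/

/-- The variables attached to the vertical steps at abscissa `i`: `yt i` and `zt i` for the north
and south steps of the top path, `yb i` and `zb i` for the north and south steps of the bottom
path. Polygons of width `m` involve only the variables with index `i ≤ m`. -/
inductive StepVar
  | yt (i : ℕ)
  | zt (i : ℕ)
  | yb (i : ℕ)
  | zb (i : ℕ)

/-- The exponents of the monomial attached to a polygon of width `m`. -/
def ColumnConvexPolygon.weight {m : ℕ} (P : ColumnConvexPolygon m) : StepVar →₀ ℕ :=
  ∑ i ∈ Finset.range (m + 1),
    (Finsupp.single (.yt i) (stepsAt P.top .N i) + Finsupp.single (.zt i) (stepsAt P.top .S i) +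
      Finsupp.single (.yb i) (stepsAt P.bot .N i) + Finsupp.single (.zb i) (stepsAt P.bot .S i))

/-- The polygons of width `m` in the class `c` with a given monomial. -/
def PolygonClass.withWeight (c : PolygonClass) (m : ℕ) (e : StepVar →₀ ℕ) :
    Set (ColumnConvexPolygon m) :=
  {P | c.Mem P ∧ P.weight = e}

/-- The generating function of the polygons of width `m` in the class `c`. -/
def PolygonClass.genFun (c : PolygonClass) (m : ℕ) : MvPowerSeries StepVar ℝ :=
  fun e => ((c.withWeight m e).ncard : ℝ)

open RationalFun in
/-- The monomial factor of the reciprocity relation. -/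
def PolygonClass.factor (c : PolygonClass) (m : ℕ) : RationalFun StepVar :=
  match c with
  | .ferrers => (-1) ^ m * var (.yb m) ^ ((m : ℤ) - 2) / var (.yt 0) *
      ∏ i ∈ Finset.Ico 1 m, var (.yt i)
  | .stack => -(var (.yb m) ^ (2 * (m : ℤ) - 3) / var (.yt 0)) *
      ∏ i ∈ Finset.Ico 1 m, (var (.yt i) * var (.zb i))
  | .staircase => -∏ i ∈ Finset.Ico 1 m, (var (.yb i) * var (.yt i))
  | .barGraph => (-1) ^ m / (var (.yt 0) * var (.yb m))
  | .columnConvex => -(1 / (var (.yt 0) * var (.yb m)))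

end

/-! A column-convex polygon is determined by the height of its first column and by the displacements
p and q of its top and bottom paths at each inner abscissa; the last climb of the bottom path is
forced, because it closes the polygon. Self-avoidance constrains one abscissa at a time: the two
vertical runs there must be disjoint (`Admissible`). Hence the generating function V(h) of the right
parts behind a column of height h arises from h ↦ y_m^h, the weight of the last climb, by one
transfer operator per inner abscissa.

This operator maps x^h, for h ≥ 1, to A x^h + B z^h + C y^h with explicit rational A, B, C, where z
and y are the weights of a south step of the top path and a north step of the bottom path
(`transfer_closed_form`). So V(h) is a finite sum of b_i x_i^h over variables x_i, and summing over
the first column turns the generating function into the sum of b_i t_i / (1 - t_i) with t_i = y_0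
x_i.

Reciprocity can be checked on A, B, C. Inverting all variables multiplies A by a Laurent monomial μ,
up to sign, and B and C by the same μ times a ratio δ(z)/δ(x) or δ(y)/δ(x). These ratios telescope,
so each b_i is multiplied by a common M times δ(x_i) (`PolygonClass.exists_expSum`). Moreover t / (1
- t) becomes -1 / (1 - t). With δ(x) = x / y_m every summand acquires the same factor -M / (y_0
y_m). For staircase polygons δ = 1 instead, and for m ≥ 2 the b_i add up to 0, so that t / (1 - t)
may be replaced by 1 / (1 - t) in the sum.

The five classes are treated together: each consists of the polygons avoiding certain vertical steps
(`PolygonClass.mem_iff`), so its series is obtained by setting the corresponding letters to 0. The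
b_i have denominators such as x - y, which are not units among power series; identities are
therefore compared in the fraction field `SeriesField`, after clearing denominators
(`RationalFun.tsum_mul_expSum`). -/

open scoped MvPowerSeries.WithPiTopology

/-! ### Summable families of power series -/

section PowerSeries

variable {σ ι : Type*}

theorem hasSum_iff_of_eq {α : Type*} [AddCommMonoid α] [TopologicalSpace α] {f g : ι → α} {s : α}
    (h : ∀ i, f i = g i) : HasSum f s ↔ HasSum g s := by
  rw [funext h]

/-- The coefficient at `d` only sees the finitely many indices with `s i ≤ d.degree`, so
coefficientwise every sum is finite. -/
theorem MvPowerSeries.summable_of_natCast_le_order {f : ι → MvPowerSeries σ ℝ} (s : ι → ℕ)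
    (hs : ∀ i, (s i : ℕ∞) ≤ (f i).order) (hfin : ∀ N, {i | s i ≤ N}.Finite) : Summable f := by
  rw [MvPowerSeries.WithPiTopology.summable_iff_summable_coeff]
  intro d
  refine summable_of_hasFiniteSupport ((hfin d.degree).subset fun i hi => ?_)
  by_contra h
  refine hi (MvPowerSeries.coeff_of_lt_order (lt_of_lt_of_le ?_ (hs i)))
  exact_mod_cast not_le.mp h

theorem MvPowerSeries.add_le_order_mul {f g : MvPowerSeries σ ℝ} {m n : ℕ}
    (hf : (m : ℕ∞) ≤ f.order) (hg : (n : ℕ∞) ≤ g.order) : ((m + n : ℕ) : ℕ∞) ≤ (f * g).order := by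
  push_cast
  exact (add_le_add hf hg).trans MvPowerSeries.le_order_mul

/-- The weight `u ^ p` of a vertical run of `p ≥ 0` north steps, or `d ^ (-p)` of `-p ≥ 0` south
steps. -/
def runWeight {R : Type*} [CommSemiring R] (u d : R) (p : ℤ) : R := u ^ p.toNat * d ^ (-p).toNat

theorem natAbs_le_order_runWeight {u d : MvPowerSeries σ ℝ} (hu : u.constantCoeff = 0)
    (hd : d.constantCoeff = 0) (p : ℤ) : (p.natAbs : ℕ∞) ≤ (runWeight u d p).order := by
  have : p.natAbs = p.toNat + (-p).toNat := by omega
  rw [this]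
  exact MvPowerSeries.add_le_order_mul
    (MvPowerSeries.le_order_pow_of_constantCoeff_eq_zero _ hu)
    (MvPowerSeries.le_order_pow_of_constantCoeff_eq_zero _ hd)

/-- The top and bottom sides of a column of height `h` may move by `p` and `q` when the next column
is entered. -/
def Admissible (h p q : ℤ) : Prop := q < h ∧ 0 < h + p ∧ q < h + p

instance (h p q : ℤ) : Decidable (Admissible h p q) := by unfold Admissible; infer_instance

/-- Columns never become empty. This is why formulas valid only for heights at least 1 can be fed
back into the transfer operator. -/
theorem Admissible.pos {h p q : ℤ} (H : Admissible h p q) : 0 < h + p - q := by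
  unfold Admissible at H; omega

/-- The weight of a pair of moves. -/
def moveWeight {R : Type*} [CommSemiring R] (a z y w : R) (h p q : ℤ) : R :=
  if Admissible h p q then runWeight a z p * runWeight y w q else 0

theorem natAbs_add_natAbs_le_order_moveWeight {a z y w : MvPowerSeries σ ℝ}
    (ha : a.constantCoeff = 0) (hz : z.constantCoeff = 0) (hy : y.constantCoeff = 0)
    (hw : w.constantCoeff = 0) (h p q : ℤ) :
    ((p.natAbs + q.natAbs : ℕ) : ℕ∞) ≤ (moveWeight a z y w h p q).order := by
  unfold moveWeight
  split_ifs
  · exact MvPowerSeries.add_le_order_mul (natAbs_le_order_runWeight ha hz p)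
      (natAbs_le_order_runWeight hy hw q)
  · simp

theorem finite_natAbs_add_natAbs_le (N : ℕ) :
    {pq : ℤ × ℤ | pq.1.natAbs + pq.2.natAbs ≤ N}.Finite := by
  refine ((Set.finite_Icc (-(N : ℤ)) N).prod (Set.finite_Icc (-(N : ℤ)) N)).subset ?_
  rintro ⟨p, q⟩ h
  simp only [Set.mem_ofPred_eq] at h
  simp only [Set.mem_prod, Set.mem_Icc]
  omega

/-- The moves alone force the order to be at least `|p| + |q|`; multiplication by an arbitrary
series cannot lower it. -/
theorem summable_moveWeight_mul {a z y w : MvPowerSeries σ ℝ}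
    (ha : a.constantCoeff = 0) (hz : z.constantCoeff = 0) (hy : y.constantCoeff = 0)
    (hw : w.constantCoeff = 0) (h : ℤ) (g : ℤ × ℤ → MvPowerSeries σ ℝ) :
    Summable fun pq : ℤ × ℤ => moveWeight a z y w h pq.1 pq.2 * g pq := by
  refine MvPowerSeries.summable_of_natCast_le_order (fun pq => pq.1.natAbs + pq.2.natAbs)
    (fun pq => ?_) finite_natAbs_add_natAbs_le
  exact (natAbs_add_natAbs_le_order_moveWeight ha hz hy hw h pq.1 pq.2).trans
    (le_self_add.trans MvPowerSeries.le_order_mul)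

theorem hasSum_geometric_mul {x : MvPowerSeries σ ℝ} (hx : x.constantCoeff = 0)
    (c : MvPowerSeries σ ℝ) : HasSum (fun n : ℕ => x ^ n * c) ((∑' n : ℕ, x ^ n) * c) :=
  (MvPowerSeries.WithPiTopology.summable_pow_of_constantCoeff_eq_zero hx).hasSum.mul_right c

/-- The sum of the weights of all moves of the bottom side, when the top side moves from height
`h` to height `h + p` and `x` marks the height of the next column. -/
theorem hasSum_bottom_moves (y : MvPowerSeries σ ℝ) {w x : MvPowerSeries σ ℝ}
    (hw : w.constantCoeff = 0) (t u : ℕ) (hut : u ≤ t) :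
    HasSum (fun q : ℤ => if q < u then runWeight y w q * x ^ (t - q : ℤ).toNat else 0)
      (∑ j ∈ Finset.range u, y ^ j * x ^ (t - j) + (∑' n : ℕ, (w * x) ^ n) * (w * x * x ^ t)) := by
  -- Rises `0 ≤ q < u` give the finite sum, descents `q = -(n + 1)` the geometric series.
  refine HasSum.of_nat_of_neg_add_one ?_ ?_
  · have h := hasSum_sum_of_ne_finset_zero (s := Finset.range u) (L := .unconditional ℕ)
      (f := fun q : ℕ => if (q : ℤ) < u then runWeight y w q * x ^ (t - q : ℤ).toNat else 0)
      (by intro b hb; rw [if_neg]; simpa using hb)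
    convert h using 1
    refine Finset.sum_congr rfl fun j hj => ?_
    rw [Finset.mem_range] at hj
    rw [if_pos (by exact_mod_cast hj)]
    have h1 : ((t : ℤ) - j).toNat = t - j := by omega
    simp [runWeight, h1]
  · have hx : (w * x).constantCoeff = 0 := by simp [hw]
    refine (hasSum_iff_of_eq fun n => ?_).mpr (hasSum_geometric_mul hx (w * x * x ^ t))
    rw [if_pos (by omega)]
    have h1 : (-((n : ℤ) + 1)).toNat = 0 := by omega
    have h2 : (-(-((n : ℤ) + 1))).toNat = n + 1 := by omega
    have h3 : ((t : ℤ) - -((n : ℤ) + 1)).toNat = t + (n + 1) := by omega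
    simp only [runWeight, h1, h2, h3]
    ring

/-- The sum of `hasSum_bottom_moves`. -/
noncomputable def bottomSum (y w x : MvPowerSeries σ ℝ) (t u : ℕ) : MvPowerSeries σ ℝ :=
  ∑ j ∈ Finset.range u, y ^ j * x ^ (t - j) + (∑' n : ℕ, (w * x) ^ n) * (w * x * x ^ t)

/-- When the top side rises by `n`, the bound `q < h` on the bottom move stays the same and every
resulting column is higher by `n`. -/
theorem bottomSum_add (y w x : MvPowerSeries σ ℝ) (h n : ℕ) :
    bottomSum y w x (h + n) h = x ^ n * bottomSum y w x h h := by
  have : ∀ j ∈ Finset.range h, y ^ j * x ^ (h + n - j) = x ^ n * (y ^ j * x ^ (h - j)) := by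
    intro j hj
    rw [Finset.mem_range] at hj
    rw [show h + n - j = n + (h - j) by omega]
    ring
  rw [bottomSum, bottomSum, Finset.sum_congr rfl this, ← Finset.mul_sum]
  ring

/-- The transfer operator, applied to the function `h ↦ x ^ h`. -/
theorem hasSum_moves {a z y w x : MvPowerSeries σ ℝ}
    (ha : a.constantCoeff = 0) (hz : z.constantCoeff = 0) (hy : y.constantCoeff = 0)
    (hw : w.constantCoeff = 0) {h : ℕ} (hh : 1 ≤ h) :
    HasSum (fun pq : ℤ × ℤ => moveWeight a z y w h pq.1 pq.2 * x ^ (h + pq.1 - pq.2 : ℤ).toNat)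
      ((∑' n : ℕ, (a * x) ^ n) * bottomSum y w x h h +
        ∑ i ∈ Finset.range (h - 1), z ^ (i + 1) * bottomSum y w x (h - 1 - i) (h - 1 - i)) := by
  have hsum := (summable_moveWeight_mul ha hz hy hw h
    fun pq => x ^ (h + pq.1 - pq.2 : ℤ).toNat).hasSum
  -- For fixed `p`, admissibility means `0 < h + p` and `q < min h (h + p)`, so the inner sum is one
  -- sum of bottom moves.
  have hin : ∀ p : ℤ, HasSum (fun q : ℤ => moveWeight a z y w h p q * x ^ (h + p - q : ℤ).toNat)
      (if 0 < h + p then runWeight a z p * bottomSum y w x (h + p).toNat (min h (h + p).toNat)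
        else 0) := by
    intro p
    split_ifs with hp
    · refine (hasSum_iff_of_eq fun q => ?_).mpr ((hasSum_bottom_moves y (x := x) hw (h + p).toNat
        (min h (h + p).toNat) (min_le_right _ _)).mul_left (runWeight a z p))
      have h1 : (((h + p).toNat : ℕ) : ℤ) = h + p := by omega
      rw [moveWeight, h1]
      by_cases hq : q < h ∧ q < h + p
      · rw [if_pos (show Admissible h p q from ⟨hq.1, hp, hq.2⟩), if_pos (by omega)]
        ring
      · rw [if_neg (show ¬ Admissible h p q from fun H => hq ⟨H.1, H.2.2⟩), if_neg (by omega)]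
        ring
    · refine (hasSum_iff_of_eq fun q => ?_).mpr hasSum_zero
      rw [moveWeight, if_neg (by unfold Admissible; tauto), zero_mul]
  have hout := hsum.prod_fiberwise hin
  refine (hout.unique (HasSum.of_nat_of_neg_add_one ?_ ?_)) ▸ hsum
  -- Rises of the top side: the factor `x ^ n` of `bottomSum_add` makes the sum geometric.
  · have hx : (a * x).constantCoeff = 0 := by simp [ha]
    refine (hasSum_iff_of_eq fun n => ?_).mpr (hasSum_geometric_mul hx (bottomSum y w x h h))
    have h1 : ((h : ℤ) + n).toNat = h + n := by omega
    rw [if_pos (by omega), h1, min_eq_left (by omega), bottomSum_add]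
    simp only [runWeight, Int.toNat_natCast, Int.toNat_neg_natCast, pow_zero, mul_one]
    ring
  -- Descents of the top side by `j + 1`: the bound on `q` drops to `h - 1 - j` as well, and only
  -- the finitely many `j` that keep it positive contribute.
  · have hs := hasSum_sum_of_ne_finset_zero (s := Finset.range (h - 1)) (L := .unconditional ℕ)
      (f := fun n : ℕ => if 0 < (h : ℤ) + -((n : ℤ) + 1) then runWeight a z (-((n : ℤ) + 1)) *
        bottomSum y w x ((h : ℤ) + -((n : ℤ) + 1)).toNat
          (min h ((h : ℤ) + -((n : ℤ) + 1)).toNat) else 0)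
      (by intro b hb; rw [if_neg]; rw [Finset.mem_range] at hb; omega)
    convert hs using 1
    refine Finset.sum_congr rfl fun j hj => ?_
    rw [Finset.mem_range] at hj
    have h1 : (-((j : ℤ) + 1)).toNat = 0 := by omega
    have h2 : (-(-((j : ℤ) + 1))).toNat = j + 1 := by omega
    have h3 : ((h : ℤ) + -((j : ℤ) + 1)).toNat = h - 1 - j := by omega
    rw [if_pos (by omega), h3, min_eq_right (by omega)]
    simp only [runWeight, h1, h2, pow_zero, one_mul]

end PowerSeries

/-! ### The transfer operator in closed form -/

section ClosedForm

variable {E : Type*} [Field E]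

theorem sum_range_pow_mul_pow_sub {x y : E} (hxy : x ≠ y) (n : ℕ) :
    ∑ j ∈ Finset.range n, y ^ j * x ^ (n - j) = x / (x - y) * x ^ n - x / (x - y) * y ^ n := by
  have h := sub_ne_zero.mpr hxy
  induction n with
  | zero => simp
  | succ n ih =>
    have : ∀ j ∈ Finset.range n, y ^ j * x ^ (n + 1 - j) = y ^ j * x ^ (n - j) * x := by
      intro j hj
      rw [Finset.mem_range] at hj
      rw [show n + 1 - j = n - j + 1 by omega]
      ring
    rw [Finset.sum_range_succ, Finset.sum_congr rfl this, ← Finset.sum_mul, ih]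
    simp only [Nat.add_sub_cancel_left]
    field_simp
    ring

/-- The degenerate alternative serves the classes in which both letters are forbidden; with `u = z =
0` both sides vanish, division by zero included. -/
theorem sum_range_pow_succ_mul_pow_sub {u z : E} (huz : u ≠ z ∨ (u = 0 ∧ z = 0)) (n : ℕ) :
    ∑ i ∈ Finset.range n, z ^ (i + 1) * u ^ (n - i) =
      z / (u - z) * u ^ (n + 1) - u / (u - z) * z ^ (n + 1) := by
  rcases huz with huz | ⟨rfl, rfl⟩
  · have h := sub_ne_zero.mpr huz
    have h1 : ∀ i ∈ Finset.range n, z ^ (i + 1) * u ^ (n - i) = z * (z ^ i * u ^ (n - i)) := by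
      intro i _
      ring
    rw [Finset.sum_congr rfl h1, ← Finset.mul_sum, sum_range_pow_mul_pow_sub huz]
    ring
  · simp

/-- The coefficient of `x ^ h` in the image of `h ↦ x ^ h` under the transfer operator. -/
def coeffMain (a z y w x : E) : E :=
  (w * x / (1 - w * x) + x / (x - y)) * (1 / (1 - a * x) + z / (x - z))

/-- The coefficient of `z ^ h` in the image of `h ↦ x ^ h` under the transfer operator. -/
def coeffTop (z y w x : E) : E :=
  x / (x - y) * (y / (y - z)) - (w * x / (1 - w * x) + x / (x - y)) * (x / (x - z))

/-- The coefficient of `y ^ h` in the image of `h ↦ x ^ h` under the transfer operator. -/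
def coeffBot (a z y x : E) : E := -(x / (x - y) * (1 / (1 - a * x) + z / (y - z)))

/-- The inner sums are combinations of powers of `x` and of `y`; the outer sum convolves each of
them with powers of `z`. Homogeneous geometric sums then produce no base besides `x`, `y` and `z`.
-/
theorem transfer_closed_form {a z y w x : E} (hxy : x ≠ y) (hxz : x ≠ z)
    (hyz : y ≠ z ∨ (y = 0 ∧ z = 0)) {h : ℕ} (hh : 1 ≤ h) :
    1 / (1 - a * x) *
        (∑ j ∈ Finset.range h, y ^ j * x ^ (h - j) + 1 / (1 - w * x) * (w * x * x ^ h)) +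
      ∑ i ∈ Finset.range (h - 1), z ^ (i + 1) *
        (∑ j ∈ Finset.range (h - 1 - i), y ^ j * x ^ (h - 1 - i - j) +
          1 / (1 - w * x) * (w * x * x ^ (h - 1 - i))) =
      coeffMain a z y w x * x ^ h + coeffTop z y w x * z ^ h + coeffBot a z y x * y ^ h := by
  obtain ⟨n, rfl⟩ : ∃ n, h = n + 1 := ⟨h - 1, by omega⟩
  have hinner : ∀ k : ℕ, ∑ j ∈ Finset.range k, y ^ j * x ^ (k - j) +
      1 / (1 - w * x) * (w * x * x ^ k) =
      (w * x / (1 - w * x) + x / (x - y)) * x ^ k - x / (x - y) * y ^ k := by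
    intro k
    rw [sum_range_pow_mul_pow_sub hxy]
    ring
  have houter : ∑ i ∈ Finset.range n, z ^ (i + 1) *
      ((w * x / (1 - w * x) + x / (x - y)) * x ^ (n - i) - x / (x - y) * y ^ (n - i)) =
      (w * x / (1 - w * x) + x / (x - y)) * ∑ i ∈ Finset.range n, z ^ (i + 1) * x ^ (n - i) -
        x / (x - y) * ∑ i ∈ Finset.range n, z ^ (i + 1) * y ^ (n - i) := by
    rw [Finset.mul_sum, Finset.mul_sum, ← Finset.sum_sub_distrib]
    refine Finset.sum_congr rfl fun i _ => ?_
    ring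
  simp only [hinner, Nat.add_sub_cancel]
  rw [houter, sum_range_pow_succ_mul_pow_sub (Or.inl hxz), sum_range_pow_succ_mul_pow_sub hyz]
  unfold coeffMain coeffTop coeffBot
  ring

end ClosedForm

/-! ### Expansions of rational functions -/

/-- The field of fractions of the ring of formal power series. -/
abbrev SeriesField (σ : Type*) : Type _ := FractionRing (MvPowerSeries σ ℝ)

noncomputable section

namespace RationalFun

variable {σ : Type*}

theorem polyToSeries_injective (σ : Type*) :
    Function.Injective ((algebraMap (MvPowerSeries σ ℝ) (SeriesField σ)).comp
      (MvPolynomial.coeToMvPowerSeries.ringHom (σ := σ) (R := ℝ))) :=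
  (IsFractionRing.injective (MvPowerSeries σ ℝ) (SeriesField σ)).comp
    (MvPolynomial.coe_injective σ ℝ)

/-- The embedding of the rational functions into the field of fractions of the ring of formal
power series. -/
def expand (σ : Type*) : RationalFun σ →+* SeriesField σ :=
  IsFractionRing.lift (polyToSeries_injective σ)

theorem expand_algebraMap (p : MvPolynomial σ ℝ) :
    expand σ (algebraMap _ _ p) = algebraMap (MvPowerSeries σ ℝ) _ (p : MvPowerSeries σ ℝ) :=
  IsFractionRing.lift_algebraMap _ _

theorem expand_var (i : σ) :
    expand σ (var i) = algebraMap (MvPowerSeries σ ℝ) _ (MvPowerSeries.X i) := by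
  rw [var, expand_algebraMap, MvPolynomial.coe_X]

/-- Writing `f = p / q` and clearing `q` gives an identity between images of power series, which
descends because the series ring embeds in its fraction field. -/
theorem isExpansion_of_expand_eq {F : MvPowerSeries σ ℝ} {f : RationalFun σ}
    (h : algebraMap _ _ F = expand σ f) : IsExpansion F f := by
  obtain ⟨p, q, hq, rfl⟩ := IsFractionRing.div_surjective (A := MvPolynomial σ ℝ) f
  have hq0 := nonZeroDivisors.ne_zero hq
  refine ⟨p, q, hq0, rfl, IsFractionRing.injective (MvPowerSeries σ ℝ) (SeriesField σ) ?_⟩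
  rw [map_mul, h, map_div₀, expand_algebraMap, expand_algebraMap, mul_div_cancel₀]
  rw [← expand_algebraMap]
  simpa using hq0

theorem recip_var (i : σ) : recip (var i) = (var i)⁻¹ := by
  rw [var, recip, IsFractionRing.liftAlgHom_apply]
  erw [IsFractionRing.lift_algebraMap (polyInv_injective σ) (MvPolynomial.X i)]
  exact MvPolynomial.aeval_X _ _

theorem expand_geometric (f : RationalFun σ) {x : MvPowerSeries σ ℝ}
    (hx : x.constantCoeff = 0) (h : algebraMap _ _ x = expand σ f) :
    algebraMap _ _ (∑' n : ℕ, x ^ n) = expand σ (1 / (1 - f)) := by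
  have h1 := MvPowerSeries.WithPiTopology.tsum_pow_mul_one_sub_of_constantCoeff_eq_zero hx
  have h2 := congrArg (algebraMap _ (SeriesField σ)) h1
  rw [map_mul, map_sub, map_one, h] at h2
  rw [map_div₀, map_sub, map_one]
  exact eq_one_div_of_mul_eq_one_left h2

/-- Makes polynomials, and hence power series, out of coefficients whose denominators are not
invertible series. -/
theorem exists_common_denominator (s : Finset (RationalFun σ)) :
    ∃ D : MvPolynomial σ ℝ, D ≠ 0 ∧ ∀ c ∈ s, ∃ P : MvPolynomial σ ℝ,
      algebraMap _ _ D * c = algebraMap _ _ P := by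
  obtain ⟨b, hb⟩ := IsLocalization.exist_integer_multiples_of_finset
    (nonZeroDivisors (MvPolynomial σ ℝ)) s
  refine ⟨b, nonZeroDivisors.ne_zero b.2, fun c hc => ?_⟩
  obtain ⟨P, hP⟩ := hb c hc
  exact ⟨P, by rw [hP, Algebra.smul_def]⟩

end RationalFun

end

noncomputable section

/-! ### Sums over sequences of moves -/

section Codes

variable {σ : Type*}

/-- The weight of the part of a column-convex polygon to the right of a column of height `h`, when
`n` more columns follow, the first of them starting at abscissa `k`, and `d` lists the moves of the
two sides. -/
def movesWeight (ω : StepVar → MvPowerSeries σ ℝ) :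
    (n k : ℕ) → ℤ → (Fin n → ℤ × ℤ) → MvPowerSeries σ ℝ
  | 0, k, h, _ => ω (.yb k) ^ h.toNat
  | n + 1, k, h, d =>
    moveWeight (ω (.yt k)) (ω (.zt k)) (ω (.yb k)) (ω (.zb k)) h (d 0).1 (d 0).2 *
      movesWeight ω n (k + 1) (h + (d 0).1 - (d 0).2) (Fin.tail d)

/-- The sum of `movesWeight` over all sequences of moves. -/
def movesSum (ω : StepVar → MvPowerSeries σ ℝ) (n k : ℕ) (h : ℤ) : MvPowerSeries σ ℝ :=
  ∑' d, movesWeight ω n k h d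

/-- The total length of the moves. -/
def movesLength {n : ℕ} (d : Fin n → ℤ × ℤ) : ℕ := ∑ i, ((d i).1.natAbs + (d i).2.natAbs)

theorem finite_movesLength_le (n N : ℕ) : {d : Fin n → ℤ × ℤ | movesLength d ≤ N}.Finite := by
  refine (Set.Finite.pi' fun _ => finite_natAbs_add_natAbs_le N).subset fun d hd i => ?_
  exact (Finset.single_le_sum (f := fun i => (d i).1.natAbs + (d i).2.natAbs)
    (fun _ _ => Nat.zero_le _) (Finset.mem_univ i)).trans hd

variable {ω : StepVar → MvPowerSeries σ ℝ}

theorem movesLength_le_order (hω : ∀ v, (ω v).constantCoeff = 0) (n k : ℕ) (h : ℤ)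
    (d : Fin n → ℤ × ℤ) : (movesLength d : ℕ∞) ≤ (movesWeight ω n k h d).order := by
  induction n generalizing k h with
  | zero => simp [movesLength]
  | succ n ih =>
    rw [movesLength, Fin.sum_univ_succ]
    exact MvPowerSeries.add_le_order_mul
      (natAbs_add_natAbs_le_order_moveWeight (hω _) (hω _) (hω _) (hω _) _ _ _)
      (ih (k + 1) _ (Fin.tail d))

theorem summable_movesWeight (hω : ∀ v, (ω v).constantCoeff = 0) (n k : ℕ) (h : ℤ) :
    Summable (movesWeight ω n k h) :=
  MvPowerSeries.summable_of_natCast_le_order movesLength (movesLength_le_order hω n k h)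
    (finite_movesLength_le n)

theorem movesSum_zero (k : ℕ) (h : ℤ) : movesSum ω 0 k h = ω (.yb k) ^ h.toNat := by
  rw [movesSum, tsum_fintype, Fintype.sum_unique, movesWeight]

/-- The first move is split off; summability of the whole family allows summation fibre by fibre. -/
theorem movesSum_succ (hω : ∀ v, (ω v).constantCoeff = 0) (n k : ℕ) (h : ℤ) :
    movesSum ω (n + 1) k h = ∑' pq : ℤ × ℤ,
      moveWeight (ω (.yt k)) (ω (.zt k)) (ω (.yb k)) (ω (.zb k)) h pq.1 pq.2 *
        movesSum ω n (k + 1) (h + pq.1 - pq.2) := by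
  have h1 := (summable_movesWeight hω (n + 1) k h).hasSum
  rw [← (Fin.consEquiv fun _ : Fin (n + 1) => ℤ × ℤ).hasSum_iff] at h1
  refine (h1.prod_fiberwise fun pq => ?_).tsum_eq.symm
  refine (hasSum_iff_of_eq fun d => ?_).mpr
    ((summable_movesWeight hω n (k + 1) (h + pq.1 - pq.2)).hasSum.mul_left
      (moveWeight (ω (.yt k)) (ω (.zt k)) (ω (.yb k)) (ω (.zb k)) h pq.1 pq.2))
  have h2 : Fin.tail (Fin.consEquiv (fun _ : Fin (n + 1) => ℤ × ℤ) (pq, d)) = d :=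
    Fin.tail_cons (α := fun _ => ℤ × ℤ) _ _
  simp only [Function.comp_apply, movesWeight, Fin.consEquiv_apply, Fin.cons_zero, h2]

/-- The weight of the polygon whose first column has height `h` and whose sides then make the
moves `d`. -/
def codeWeight (ω : StepVar → MvPowerSeries σ ℝ) (n : ℕ) (a : ℤ × (Fin n → ℤ × ℤ)) :
    MvPowerSeries σ ℝ :=
  if 0 < a.1 then ω (.yt 0) ^ a.1.toNat * movesWeight ω n 1 a.1 a.2 else 0

theorem summable_codeWeight (hω : ∀ v, (ω v).constantCoeff = 0) (n : ℕ) :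
    Summable (codeWeight ω n) := by
  refine MvPowerSeries.summable_of_natCast_le_order (fun a => a.1.natAbs + movesLength a.2)
    (fun a => ?_) fun N => ?_
  · unfold codeWeight
    split_ifs with h
    · rw [show a.1.natAbs = a.1.toNat by omega]
      exact MvPowerSeries.add_le_order_mul
        (MvPowerSeries.le_order_pow_of_constantCoeff_eq_zero _ (hω _))
        (movesLength_le_order hω _ _ _ _)
    · simp
  · refine ((Set.finite_Icc (-(N : ℤ)) N).prod (finite_movesLength_le n N)).subset ?_
    rintro ⟨h, d⟩ hd
    simp only [Set.mem_ofPred_eq] at hd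
    simp only [Set.mem_prod, Set.mem_Icc, Set.mem_ofPred_eq]
    omega

/-- The sum of `codeWeight` over all codes, by the height of the first column. -/
theorem hasSum_tsum_codeWeight (hω : ∀ v, (ω v).constantCoeff = 0) (n : ℕ) :
    HasSum (fun h : ℕ => ω (.yt 0) ^ (h + 1) * movesSum ω n 1 ((h + 1 : ℕ) : ℤ))
      (∑' a, codeWeight ω n a) := by
  have h1 := (summable_codeWeight hω n).hasSum.prod_fiberwise
    (g := fun h => if 0 < h then ω (.yt 0) ^ h.toNat * movesSum ω n 1 h else 0) fun h => by
      by_cases h0 : 0 < h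
      · rw [if_pos h0]
        refine (hasSum_iff_of_eq fun d => ?_).mpr
          ((summable_movesWeight hω n 1 h).hasSum.mul_left (ω (.yt 0) ^ h.toNat))
        rw [codeWeight, if_pos h0]
      · rw [if_neg h0]
        refine (hasSum_iff_of_eq fun d => ?_).mpr hasSum_zero
        rw [codeWeight, if_neg h0]
  have hinj : Function.Injective (fun h : ℕ => ((h + 1 : ℕ) : ℤ)) := fun a b hab => by
    simpa using hab
  rw [← hinj.hasSum_iff] at h1
  · refine (hasSum_iff_of_eq fun h => ?_).mp h1
    simp only [Function.comp_apply]
    rw [if_pos (by positivity), Int.toNat_natCast]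
  · intro h hh
    rw [if_neg]
    intro h0
    exact hh ⟨h.toNat - 1, by simp only; omega⟩

end Codes

/-! ### Sums of exponentials -/

namespace RationalFun

variable {ι : Type} [Fintype ι] {σ : Type*} {x : ι → σ} {c : ι → RationalFun σ}
  {V : ℕ → MvPowerSeries σ ℝ}

/-- A summation operator can be applied termwise to a sum of exponentials, even if the single
coefficients are no power series. -/
theorem tsum_mul_expSum {κ : Type*}
    (hV : ∀ h, 1 ≤ h → algebraMap _ (SeriesField σ) (V h) =
      ∑ i, expand σ (c i) * algebraMap _ _ ((MvPowerSeries.X (x i) : MvPowerSeries σ ℝ) ^ h))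
    {u : κ → MvPowerSeries σ ℝ} {N : κ → ℕ} (hN : ∀ j, u j ≠ 0 → 1 ≤ N j)
    (hs : Summable fun j => u j * V (N j)) {S : ι → MvPowerSeries σ ℝ}
    (hS : ∀ i, HasSum (fun j => u j * MvPowerSeries.X (x i) ^ N j) (S i)) :
    algebraMap _ (SeriesField σ) (∑' j, u j * V (N j)) =
      ∑ i, expand σ (c i) * algebraMap _ _ (S i) := by
  classical
  obtain ⟨D, hD, hc⟩ := exists_common_denominator (Finset.univ.image c)
  choose P hP using fun i => hc (c i) (Finset.mem_image_of_mem c (Finset.mem_univ i))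
  have hinj := IsFractionRing.injective (MvPowerSeries σ ℝ) (SeriesField σ)
  have hP' : ∀ i, algebraMap _ (SeriesField σ) (D : MvPowerSeries σ ℝ) * expand σ (c i) =
      algebraMap _ _ (P i : MvPowerSeries σ ℝ) := fun i => by
    rw [← expand_algebraMap, ← expand_algebraMap, ← map_mul, hP]
  have hD' : algebraMap _ (SeriesField σ) (D : MvPowerSeries σ ℝ) ≠ 0 := by
    rw [← expand_algebraMap]
    simpa using hD
  have hDV : ∀ h, 1 ≤ h → (D : MvPowerSeries σ ℝ) * V h =
      ∑ i, (P i : MvPowerSeries σ ℝ) * MvPowerSeries.X (x i) ^ h := by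
    intro h hh
    apply hinj
    rw [map_mul, hV h hh, map_sum, Finset.mul_sum]
    refine Finset.sum_congr rfl fun i _ => ?_
    rw [map_mul, ← hP', mul_assoc]
  -- After multiplication by `D` both sides are sums of power series, where the infinite sum
  -- commutes with the finite one over `i`. Division by `D` takes place in the field at the end.
  have h1 := hs.hasSum.mul_left (D : MvPowerSeries σ ℝ)
  have h2 : HasSum (fun j => ∑ i, (P i : MvPowerSeries σ ℝ) *
      (u j * MvPowerSeries.X (x i) ^ N j)) (∑ i, (P i : MvPowerSeries σ ℝ) * S i) :=
    hasSum_sum fun i _ => (hS i).mul_left _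
  have h3 : ∀ j, (D : MvPowerSeries σ ℝ) * (u j * V (N j)) =
      ∑ i, (P i : MvPowerSeries σ ℝ) * (u j * MvPowerSeries.X (x i) ^ N j) := by
    intro j
    -- The expansion of `V` is known only at positive heights; terms of weight 0 do not need it.
    by_cases hu : u j = 0
    · simp [hu]
    · rw [mul_left_comm, hDV _ (hN j hu), Finset.mul_sum]
      exact Finset.sum_congr rfl fun i _ => mul_left_comm _ _ _
  have h4 := congrArg (algebraMap _ (SeriesField σ)) (h1.unique ((hasSum_iff_of_eq h3).mpr h2))
  rw [map_mul, map_sum] at h4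
  apply mul_left_cancel₀ hD'
  rw [h4, Finset.mul_sum]
  refine Finset.sum_congr rfl fun i _ => ?_
  rw [map_mul, ← hP', mul_assoc]

theorem expand_ne {f g : RationalFun σ} (h : f ≠ g) : expand σ f ≠ expand σ g :=
  (expand σ).injective.ne h

theorem expand_coeffMain (a z y w x : RationalFun σ) : expand σ (coeffMain a z y w x) =
    coeffMain (expand σ a) (expand σ z) (expand σ y) (expand σ w) (expand σ x) := by
  simp [coeffMain]

theorem expand_coeffTop (z y w x : RationalFun σ) : expand σ (coeffTop z y w x) =
    coeffTop (expand σ z) (expand σ y) (expand σ w) (expand σ x) := by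
  simp [coeffTop]

theorem expand_coeffBot (a z y x : RationalFun σ) : expand σ (coeffBot a z y x) =
    coeffBot (expand σ a) (expand σ z) (expand σ y) (expand σ x) := by
  simp [coeffBot]

/-- The transfer operator maps sums of exponentials to sums of exponentials. -/
theorem transfer_expSum
    (hV : ∀ h, 1 ≤ h → algebraMap _ (SeriesField σ) (V h) =
      ∑ i, expand σ (c i) * algebraMap _ _ ((MvPowerSeries.X (x i) : MvPowerSeries σ ℝ) ^ h))
    {a z y w : MvPowerSeries σ ℝ} (ha : a.constantCoeff = 0) (hz : z.constantCoeff = 0)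
    (hy : y.constantCoeff = 0) (hw : w.constantCoeff = 0) {a' z' y' w' : RationalFun σ}
    (ha' : algebraMap _ _ a = expand σ a') (hz' : algebraMap _ _ z = expand σ z')
    (hy' : algebraMap _ _ y = expand σ y') (hw' : algebraMap _ _ w = expand σ w')
    (hxy : ∀ i, var (x i) ≠ y') (hxz : ∀ i, var (x i) ≠ z') (hyz : y' ≠ z' ∨ (y' = 0 ∧ z' = 0))
    {h : ℕ} (hh : 1 ≤ h) :
    algebraMap _ (SeriesField σ)
        (∑' pq : ℤ × ℤ, moveWeight a z y w h pq.1 pq.2 * V (h + pq.1 - pq.2 : ℤ).toNat) =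
      ∑ i, expand σ (c i * (coeffMain a' z' y' w' (var (x i)) * var (x i) ^ h +
        coeffTop z' y' w' (var (x i)) * z' ^ h + coeffBot a' z' y' (var (x i)) * y' ^ h)) := by
  have hX : ∀ i, (MvPowerSeries.X (x i) : MvPowerSeries σ ℝ).constantCoeff = 0 := fun i =>
    MvPowerSeries.constantCoeff_X _
  rw [tsum_mul_expSum hV (u := fun pq : ℤ × ℤ => moveWeight a z y w h pq.1 pq.2)
    (N := fun pq => (h + pq.1 - pq.2 : ℤ).toNat) ?_ (summable_moveWeight_mul ha hz hy hw h _)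
    (fun i => hasSum_moves ha hz hy hw hh)]
  · refine Finset.sum_congr rfl fun i _ => ?_
    rw [map_mul]
    congr 1
    have hax := expand_geometric (a' * var (x i)) (x := a * MvPowerSeries.X (x i))
      (by simp [ha]) (by rw [map_mul, map_mul, ha', expand_var])
    have hwx := expand_geometric (w' * var (x i)) (x := w * MvPowerSeries.X (x i))
      (by simp [hw]) (by rw [map_mul, map_mul, hw', expand_var])
    have hyz' : expand σ y' ≠ expand σ z' ∨ (expand σ y' = 0 ∧ expand σ z' = 0) := by
      rcases hyz with h | ⟨rfl, rfl⟩
      · exact Or.inl (expand_ne h)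
      · simp
    have key := transfer_closed_form (a := expand σ a') (w := expand σ w') (expand_ne (hxy i))
      (expand_ne (hxz i)) hyz' hh
    simp only [map_add, map_mul, map_pow, expand_coeffMain, expand_coeffTop, expand_coeffBot]
    rw [← key]
    simp only [bottomSum, map_add, map_mul, map_sum, map_pow, hax, hwx, hw', hy', hz', expand_var,
      map_div₀, map_sub, map_one]
  · intro pq hpq
    have : Admissible h pq.1 pq.2 := by
      by_contra H
      exact hpq (if_neg H)
    have := this.pos
    omega

end RationalFun

end

noncomputable section

/-! ### Inversion of the transfer coefficients -/

section Inversion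

variable {E : Type*} [Field E] {a z y w x : E}

theorem one_sub_inv_mul_inv (hw : w ≠ 0) (hx : x ≠ 0) :
    1 - w⁻¹ * x⁻¹ = -(1 - w * x) / (w * x) := by
  field_simp
  ring

theorem inv_sub_inv_eq (hx : x ≠ 0) (hy : y ≠ 0) : x⁻¹ - y⁻¹ = -(x - y) / (x * y) := by
  field_simp
  ring

/-- Each of the two factors of `coeffMain` changes sign: inversion sends `w * x / (1 - w * x)` to
`-1` minus itself and `x / (x - y)` to `1` minus itself, and the constants cancel. The other factor
behaves in the same way. -/
theorem coeffMain_inv_columnConvex (ha : a ≠ 0) (hz : z ≠ 0) (hy : y ≠ 0) (hw : w ≠ 0) (hx : x ≠ 0)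
    (hax : 1 - a * x ≠ 0) (hwx : 1 - w * x ≠ 0) (hxy : x - y ≠ 0) (hxz : x - z ≠ 0) :
    coeffMain a⁻¹ z⁻¹ y⁻¹ w⁻¹ x⁻¹ = coeffMain a z y w x := by
  have hax' : 1 - x * a ≠ 0 := by rwa [mul_comm x a]
  have hwx' : 1 - x * w ≠ 0 := by rwa [mul_comm x w]
  unfold coeffMain
  rw [one_sub_inv_mul_inv hw hx, one_sub_inv_mul_inv ha hx, inv_sub_inv_eq hx hy,
    inv_sub_inv_eq hx hz]
  field_simp
  ring

/-- The passage from base `x` to base `z` costs the ratio `z / x`, which is a change of the gauge `δ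
x = x`; likewise `y / x` for `coeffBot`. -/
theorem coeffTop_inv_columnConvex (hz : z ≠ 0) (hy : y ≠ 0) (hw : w ≠ 0) (hx : x ≠ 0)
    (hwx : 1 - w * x ≠ 0) (hxy : x - y ≠ 0) (hxz : x - z ≠ 0) (hyz : y - z ≠ 0) :
    coeffTop z⁻¹ y⁻¹ w⁻¹ x⁻¹ * x = z * coeffTop z y w x := by
  have hwx' : 1 - x * w ≠ 0 := by rwa [mul_comm x w]
  unfold coeffTop
  rw [one_sub_inv_mul_inv hw hx, inv_sub_inv_eq hx hy, inv_sub_inv_eq hx hz, inv_sub_inv_eq hy hz]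
  field_simp
  ring

theorem coeffBot_inv_columnConvex (ha : a ≠ 0) (hz : z ≠ 0) (hy : y ≠ 0) (hx : x ≠ 0)
    (hax : 1 - a * x ≠ 0) (hxy : x - y ≠ 0) (hyz : y - z ≠ 0) :
    coeffBot a⁻¹ z⁻¹ y⁻¹ x⁻¹ * x = y * coeffBot a z y x := by
  have hax' : 1 - x * a ≠ 0 := by rwa [mul_comm x a]
  unfold coeffBot
  rw [one_sub_inv_mul_inv ha hx, inv_sub_inv_eq hx hy, inv_sub_inv_eq hy hz]
  field_simp
  ring

/-- For `y = w = 0` the first factor of `coeffMain` is 1, so only one of the two sign changes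
remains. -/
theorem coeffMain_inv_barGraph (ha : a ≠ 0) (hz : z ≠ 0) (hx : x ≠ 0)
    (hax : 1 - a * x ≠ 0) (hxz : x - z ≠ 0) :
    coeffMain a⁻¹ z⁻¹ 0 0 x⁻¹ = -1 * coeffMain a z 0 0 x := by
  have hax' : 1 - x * a ≠ 0 := by rwa [mul_comm x a]
  unfold coeffMain
  rw [one_sub_inv_mul_inv ha hx, inv_sub_inv_eq hx hz]
  field_simp
  ring

theorem coeffTop_inv_barGraph (hz : z ≠ 0) (hx : x ≠ 0) (hxz : x - z ≠ 0) :
    coeffTop z⁻¹ 0 0 x⁻¹ * x = -1 * z * coeffTop z 0 0 x := by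
  unfold coeffTop
  rw [inv_sub_inv_eq hx hz]
  field_simp
  ring

theorem coeffMain_inv_staircase (ha : a ≠ 0) (hy : y ≠ 0) (hx : x ≠ 0) (hxy : x - y ≠ 0) :
    coeffMain a⁻¹ 0 y⁻¹ 0 x⁻¹ = y * a * coeffMain a 0 y 0 x := by
  unfold coeffMain
  rw [one_sub_inv_mul_inv ha hx, inv_sub_inv_eq hx hy]
  field_simp
  ring

theorem coeffBot_inv_staircase (ha : a ≠ 0) (hy : y ≠ 0) (hx : x ≠ 0) (hxy : x - y ≠ 0) :
    coeffBot a⁻¹ 0 y⁻¹ x⁻¹ = y * a * coeffBot a 0 y x := by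
  unfold coeffBot
  rw [one_sub_inv_mul_inv ha hx, inv_sub_inv_eq hx hy]
  field_simp
  ring

/-- For `z = w = 0`, the image of `x ^ h` under the transfer operator, extended formally to `h = 0`,
vanishes there. -/
theorem coeffMain_add_coeffBot_staircase : coeffMain a 0 y 0 x + coeffBot a 0 y x = 0 := by
  unfold coeffMain coeffBot
  ring

/-- Here `coeffMain` is `1 / ((1 - a * x) * (1 - w * x))`, and each factor contributes its own
monomial with a minus sign. -/
theorem coeffMain_inv_stack (ha : a ≠ 0) (hw : w ≠ 0) (hx : x ≠ 0) (hwx : 1 - w * x ≠ 0) :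
    coeffMain a⁻¹ 0 0 w⁻¹ x⁻¹ = x ^ 2 * (a * w) * coeffMain a 0 0 w x := by
  unfold coeffMain
  rw [one_sub_inv_mul_inv ha hx, one_sub_inv_mul_inv hw hx]
  field_simp
  ring

theorem coeffMain_inv_ferrers (ha : a ≠ 0) (hx : x ≠ 0) :
    coeffMain a⁻¹ 0 0 0 x⁻¹ = -x * a * coeffMain a 0 0 0 x := by
  unfold coeffMain
  rw [one_sub_inv_mul_inv ha hx]
  field_simp
  ring

end Inversion

/-! ### The classes as specializations -/

/-- The variables that occur in the polygons of a class. -/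
def PolygonClass.Allowed (c : PolygonClass) (m : ℕ) : StepVar → Prop
  | .yt _ => True
  | .zt _ => c = .barGraph ∨ c = .columnConvex
  | .yb i => i = m ∨ c = .staircase ∨ c = .columnConvex
  | .zb _ => c = .stack ∨ c = .columnConvex

open Classical in
/-- The weight of a vertical step in the generating function of a class. -/
def PolygonClass.letter (c : PolygonClass) (m : ℕ) (v : StepVar) : MvPowerSeries StepVar ℝ :=
  if c.Allowed m v then MvPowerSeries.X v else 0

open Classical in
/-- The weight of a vertical step in the generating function of a class, as a rational function. -/
def PolygonClass.ratLetter (c : PolygonClass) (m : ℕ) (v : StepVar) : RationalFun StepVar :=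
  if c.Allowed m v then RationalFun.var v else 0

namespace PolygonClass

open RationalFun

variable {c : PolygonClass} {m k : ℕ}

theorem constantCoeff_letter (v : StepVar) : (c.letter m v).constantCoeff = 0 := by
  unfold letter
  split_ifs <;> simp

theorem algebraMap_letter (v : StepVar) :
    algebraMap _ _ (c.letter m v) = expand StepVar (c.ratLetter m v) := by
  unfold letter ratLetter
  split_ifs
  · exact (expand_var v).symm
  · simp

/-- A forbidden letter is 0 and `0⁻¹ = 0`, so allowed and forbidden letters obey one formula. -/
theorem recip_ratLetter (v : StepVar) : recip (c.ratLetter m v) = (c.ratLetter m v)⁻¹ := by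
  unfold ratLetter
  split_ifs
  · exact recip_var v
  · simp

theorem ratLetter_of_allowed {v : StepVar} (h : c.Allowed m v) : c.ratLetter m v = var v :=
  if_pos h

theorem ratLetter_of_not_allowed {v : StepVar} (h : ¬ c.Allowed m v) : c.ratLetter m v = 0 :=
  if_neg h

/-- The variables that serve as bases of exponentials in the generating function of the right parts
of the polygons that start at abscissa `k`. -/
def IsBase (c : PolygonClass) (m k : ℕ) (v : StepVar) : Prop :=
  v = .yb m ∨ ∃ j, k ≤ j ∧ j < m ∧ (v = .zt j ∨ v = .yb j) ∧ c.Allowed m v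

theorem IsBase.mono {v : StepVar} (h : c.IsBase m (k + 1) v) : c.IsBase m k v := by
  rcases h with h | ⟨j, hj, h⟩
  · exact Or.inl h
  · exact Or.inr ⟨j, by omega, h⟩

/-- Together with `IsBase.ne_yb`, this keeps the denominators `x - z` and `x - y` of the next
transfer step nonzero: the bases come from abscissas further right. -/
theorem IsBase.ne_zt {v : StepVar} (h : c.IsBase m (k + 1) v) : v ≠ .zt k := by
  rintro rfl
  rcases h with h | ⟨j, hj, _, h | h, _⟩
  · cases h
  · cases h
    omega
  · cases h

theorem IsBase.ne_yb {v : StepVar} (h : c.IsBase m (k + 1) v) (hk : k < m) : v ≠ .yb k := by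
  rintro rfl
  rcases h with h | ⟨j, hj, _, h | h, _⟩
  · cases h
    omega
  · cases h
  · cases h
    omega

theorem isBase_zt (hk : k < m) (h : c.Allowed m (.zt k)) : c.IsBase m k (.zt k) :=
  Or.inr ⟨k, le_rfl, hk, Or.inl rfl, h⟩

theorem isBase_yb (hk : k < m) (h : c.Allowed m (.yb k)) : c.IsBase m k (.yb k) :=
  Or.inr ⟨k, le_rfl, hk, Or.inr rfl, h⟩

end PolygonClass

theorem RationalFun.var_injective {σ : Type*} : Function.Injective (var : σ → RationalFun σ) :=
  (IsFractionRing.injective (MvPolynomial σ ℝ) (RationalFun σ)).comp MvPolynomial.X_injective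

namespace PolygonClass

open RationalFun

variable {c : PolygonClass} {m k : ℕ}

theorem var_ne_ratLetter {v u : StepVar} (h : v ≠ u) : var v ≠ c.ratLetter m u := by
  unfold ratLetter
  split_ifs
  · exact var_injective.ne h
  · exact var_ne_zero v

theorem ratLetter_ne {v u : StepVar} (h : v ≠ u) : c.ratLetter m v ≠ c.ratLetter m u ∨
    (c.ratLetter m v = 0 ∧ c.ratLetter m u = 0) := by
  by_cases hv : c.Allowed m v
  · rw [ratLetter_of_allowed hv]
    exact Or.inl (var_ne_ratLetter h)
  · by_cases hu : c.Allowed m u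
    · rw [ratLetter_of_allowed hu]
      exact Or.inl (var_ne_ratLetter h.symm).symm
    · exact Or.inr ⟨ratLetter_of_not_allowed hv, ratLetter_of_not_allowed hu⟩

/-- `coeffMain` with the weights of a class at abscissa `k`. -/
def mainAt (c : PolygonClass) (m k : ℕ) (x : StepVar) : RationalFun StepVar :=
  coeffMain (c.ratLetter m (.yt k)) (c.ratLetter m (.zt k)) (c.ratLetter m (.yb k))
    (c.ratLetter m (.zb k)) (var x)

/-- `coeffTop` with the weights of a class at abscissa `k`. -/
def topAt (c : PolygonClass) (m k : ℕ) (x : StepVar) : RationalFun StepVar :=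
  coeffTop (c.ratLetter m (.zt k)) (c.ratLetter m (.yb k)) (c.ratLetter m (.zb k)) (var x)

/-- `coeffBot` with the weights of a class at abscissa `k`. -/
def botAt (c : PolygonClass) (m k : ℕ) (x : StepVar) : RationalFun StepVar :=
  coeffBot (c.ratLetter m (.yt k)) (c.ratLetter m (.zt k)) (c.ratLetter m (.yb k)) (var x)

theorem recip_mainAt (x : StepVar) : recip (c.mainAt m k x) =
    coeffMain (c.ratLetter m (.yt k))⁻¹ (c.ratLetter m (.zt k))⁻¹ (c.ratLetter m (.yb k))⁻¹
      (c.ratLetter m (.zb k))⁻¹ (var x)⁻¹ := by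
  simp only [mainAt, coeffMain, map_mul, map_add, map_sub, map_div₀, map_one, recip_ratLetter,
    recip_var]

theorem recip_topAt (x : StepVar) : recip (c.topAt m k x) =
    coeffTop (c.ratLetter m (.zt k))⁻¹ (c.ratLetter m (.yb k))⁻¹
      (c.ratLetter m (.zb k))⁻¹ (var x)⁻¹ := by
  simp only [topAt, coeffTop, map_mul, map_sub, map_add, map_div₀, map_one, recip_ratLetter,
    recip_var]

theorem recip_botAt (x : StepVar) : recip (c.botAt m k x) =
    coeffBot (c.ratLetter m (.yt k))⁻¹ (c.ratLetter m (.zt k))⁻¹ (c.ratLetter m (.yb k))⁻¹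
      (var x)⁻¹ := by
  simp only [botAt, coeffBot, map_mul, map_neg, map_sub, map_add, map_div₀, map_one,
    recip_ratLetter, recip_var]

open Classical in
/-- The generating function of the right parts of polygons is a sum of exponentials, with
coefficients that are self-reciprocal if the transfer coefficients are. -/
theorem exists_expSum (c : PolygonClass) (m : ℕ) (μ : ℕ → RationalFun StepVar)
    (δ : StepVar → RationalFun StepVar) (hδ : δ (.yb m) = 1)
    (hmain : ∀ k x, 1 ≤ k → k < m → c.IsBase m (k + 1) x →
      recip (c.mainAt m k x) = μ k * c.mainAt m k x)
    (htop : ∀ k x, 1 ≤ k → k < m → c.IsBase m (k + 1) x → c.Allowed m (.zt k) →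
      recip (c.topAt m k x) * δ x = μ k * δ (.zt k) * c.topAt m k x)
    (hbot : ∀ k x, 1 ≤ k → k < m → c.IsBase m (k + 1) x → c.Allowed m (.yb k) →
      recip (c.botAt m k x) * δ x = μ k * δ (.yb k) * c.botAt m k x)
    (n k : ℕ) (hk1 : 1 ≤ k) (hk : k + n = m) :
    ∃ (ι : Type) (_ : Fintype ι) (x : ι → StepVar) (b : ι → RationalFun StepVar),
      (∀ i, c.IsBase m k (x i)) ∧
      (∀ i, recip (b i) = (∏ j ∈ Finset.Ico k m, μ j) * δ (x i) * b i) ∧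
      (∀ h : ℕ, 1 ≤ h → algebraMap _ (SeriesField StepVar) (movesSum (c.letter m) n k h) =
        ∑ i, expand StepVar (b i) *
          algebraMap _ _ ((MvPowerSeries.X (x i) : MvPowerSeries StepVar ℝ) ^ h)) ∧
      (0 < n → (∀ k x, 1 ≤ k → k < m → ¬ c.Allowed m (.zt k) ∧ c.Allowed m (.yb k) ∧
        c.mainAt m k x + c.botAt m k x = 0) → ∑ i, b i = 0) := by
  -- The factor `δ` records only the current base: a step from base `x` to base `v` contributes `δ v
  -- / δ x`, so the dependence on earlier bases cancels. The hypotheses state this without division.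
  induction n generalizing k with
  | zero =>
    obtain rfl : k = m := by omega
    refine ⟨Unit, inferInstance, fun _ => .yb k, fun _ => 1, fun _ => Or.inl rfl, fun _ => ?_,
      fun h _ => ?_, fun h => absurd h (lt_irrefl 0)⟩
    · simp [hδ]
    · rw [movesSum_zero, Int.toNat_natCast, letter,
        if_pos (show c.Allowed k (.yb k) from Or.inl rfl)]
      simp
  | succ n ih =>
    obtain ⟨ι, hι, x, b, hx, hb, hV, -⟩ := ih (k + 1) (by omega) (by omega)
    have hkm : k < m := by omega
    have hM : ∏ j ∈ Finset.Ico k m, μ j = μ k * ∏ j ∈ Finset.Ico (k + 1) m, μ j :=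
      (Finset.prod_eq_prod_Ico_succ_bot hkm μ)
    refine ⟨ι ⊕ (ι ⊕ ι), inferInstance,
      Sum.elim x (Sum.elim (fun i => if c.Allowed m (.zt k) then .zt k else x i)
        (fun i => if c.Allowed m (.yb k) then .yb k else x i)),
      Sum.elim (fun i => b i * c.mainAt m k (x i))
        (Sum.elim (fun i => if c.Allowed m (.zt k) then b i * c.topAt m k (x i) else 0)
          (fun i => if c.Allowed m (.yb k) then b i * c.botAt m k (x i) else 0)), ?_, ?_, ?_, ?_⟩
    · rintro (i | i | i)
      · exact (hx i).mono
      · simp only [Sum.elim_inr, Sum.elim_inl]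
        split_ifs with h
        · exact isBase_zt hkm h
        · exact (hx i).mono
      · simp only [Sum.elim_inr]
        split_ifs with h
        · exact isBase_yb hkm h
        · exact (hx i).mono
    · rintro (i | i | i)
      · simp only [Sum.elim_inl]
        rw [map_mul, hb, hmain k _ hk1 hkm (hx i), hM]
        ring
      · simp only [Sum.elim_inr, Sum.elim_inl]
        split_ifs with h
        · rw [map_mul, hb, hM]
          linear_combination (∏ j ∈ Finset.Ico (k + 1) m, μ j) * b i * htop k _ hk1 hkm (hx i) h
        · simp
      · simp only [Sum.elim_inr]
        split_ifs with h
        · rw [map_mul, hb, hM]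
          linear_combination (∏ j ∈ Finset.Ico (k + 1) m, μ j) * b i * hbot k _ hk1 hkm (hx i) h
        · simp
    · intro h hh
      have key := transfer_expSum (V := fun h : ℕ => movesSum (c.letter m) n (k + 1) h) hV
        (constantCoeff_letter (c := c) (m := m) (.yt k))
        (constantCoeff_letter (c := c) (m := m) (.zt k))
        (constantCoeff_letter (c := c) (m := m) (.yb k))
        (constantCoeff_letter (c := c) (m := m) (.zb k))
        (algebraMap_letter (c := c) (m := m) (.yt k))
        (algebraMap_letter (c := c) (m := m) (.zt k))
        (algebraMap_letter (c := c) (m := m) (.yb k))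
        (algebraMap_letter (c := c) (m := m) (.zb k))
        (fun i => var_ne_ratLetter ((hx i).ne_yb hkm)) (fun i => var_ne_ratLetter (hx i).ne_zt)
        (ratLetter_ne (by simp)) hh
      rw [movesSum_succ constantCoeff_letter]
      -- Heights are integers in `movesSum` but naturals in the expansion; truncation is harmless
      -- because inadmissible moves have weight 0.
      have hcast : ∀ pq : ℤ × ℤ, moveWeight (c.letter m (.yt k)) (c.letter m (.zt k))
          (c.letter m (.yb k)) (c.letter m (.zb k)) h pq.1 pq.2 *
            movesSum (c.letter m) n (k + 1) (h + pq.1 - pq.2) =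
          moveWeight (c.letter m (.yt k)) (c.letter m (.zt k))
          (c.letter m (.yb k)) (c.letter m (.zb k)) h pq.1 pq.2 *
            movesSum (c.letter m) n (k + 1) ((h + pq.1 - pq.2 : ℤ).toNat : ℤ) := by
        intro pq
        by_cases H : Admissible h pq.1 pq.2
        · rw [Int.toNat_of_nonneg H.pos.le]
        · rw [moveWeight, if_neg H, zero_mul, zero_mul]
      rw [tsum_congr hcast, key, Fintype.sum_sum_type, Fintype.sum_sum_type,
        ← Finset.sum_add_distrib, ← Finset.sum_add_distrib]
      refine Finset.sum_congr rfl fun i _ => ?_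
      simp only [Sum.elim_inl, Sum.elim_inr, map_pow, ← expand_var]
      rw [mul_add, mul_add, map_add, map_add, add_assoc]
      congr 1
      · rw [mainAt, ← map_pow, ← map_mul]
        ring_nf
      congr 1
      · split_ifs with hz
        · rw [ratLetter_of_allowed hz, topAt, ← map_pow, ← map_mul, ratLetter_of_allowed hz]
          ring_nf
        -- The exponential with base 0 disappears since `h ≥ 1`.
        · rw [ratLetter_of_not_allowed hz, zero_pow (by omega)]
          simp
      · split_ifs with hz
        · rw [ratLetter_of_allowed hz, botAt, ← map_pow, ← map_mul, ratLetter_of_allowed hz]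
          ring_nf
        · rw [ratLetter_of_not_allowed hz, zero_pow (by omega)]
          simp
    -- A single transfer step forces the sum to vanish, whatever the previous coefficients were:
    -- each `b i` is multiplied by the main plus the bottom coefficient.
    · intro _ H
      rw [Fintype.sum_sum_type, Fintype.sum_sum_type]
      simp only [Sum.elim_inl, Sum.elim_inr, if_neg (H k (.yb k) hk1 hkm).1,
        if_pos (H k (.yb k) hk1 hkm).2.1, Finset.sum_const_zero, zero_add]
      rw [← Finset.sum_add_distrib]
      refine Finset.sum_eq_zero fun i _ => ?_
      rw [← mul_add, (H k (x i) hk1 hkm).2.2, mul_zero]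

end PolygonClass

end

noncomputable section

/-! ### Signed Laurent monomials -/

namespace RationalFun

variable {σ : Type*}

/-- A Laurent monomial, up to sign. -/
def IsSignedMonomial (g : RationalFun σ) : Prop :=
  ∃ (ε : ℤˣ) (β : σ →₀ ℤ), g = ((ε : ℤ) : RationalFun σ) * (β.prod fun i b => var i ^ b)

theorem isSignedMonomial_one : IsSignedMonomial (1 : RationalFun σ) := ⟨1, 0, by simp⟩

theorem isSignedMonomial_neg_one : IsSignedMonomial (-1 : RationalFun σ) := ⟨-1, 0, by simp⟩

theorem isSignedMonomial_var (i : σ) : IsSignedMonomial (var i) :=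
  ⟨1, Finsupp.single i 1, by rw [Finsupp.prod_single_index] <;> simp⟩

theorem IsSignedMonomial.mul {f g : RationalFun σ} (hf : IsSignedMonomial f)
    (hg : IsSignedMonomial g) : IsSignedMonomial (f * g) := by
  classical
  obtain ⟨ε, β, rfl⟩ := hf
  obtain ⟨ε', β', rfl⟩ := hg
  refine ⟨ε * ε', β + β', ?_⟩
  rw [Finsupp.prod_add_index' (fun i => zpow_zero _) fun i => zpow_add₀ (var_ne_zero i)]
  push_cast
  ring

theorem IsSignedMonomial.inv {f : RationalFun σ} (hf : IsSignedMonomial f) :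
    IsSignedMonomial f⁻¹ := by
  obtain ⟨ε, β, rfl⟩ := hf
  refine ⟨ε, -β, ?_⟩
  have hε : (((ε : ℤ) : RationalFun σ))⁻¹ = ((ε : ℤ) : RationalFun σ) := by
    rcases Int.units_eq_one_or ε with rfl | rfl <;> norm_num
  rw [mul_inv, hε, Finsupp.prod_neg_index fun i => zpow_zero _]
  simp only [Finsupp.prod, zpow_neg, Finset.prod_inv_distrib]

theorem IsSignedMonomial.div {f g : RationalFun σ} (hf : IsSignedMonomial f)
    (hg : IsSignedMonomial g) : IsSignedMonomial (f / g) := by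
  rw [div_eq_mul_inv]
  exact hf.mul hg.inv

theorem IsSignedMonomial.neg {f : RationalFun σ} (hf : IsSignedMonomial f) :
    IsSignedMonomial (-f) := by
  rw [← neg_one_mul]
  exact isSignedMonomial_neg_one.mul hf

theorem IsSignedMonomial.pow {f : RationalFun σ} (hf : IsSignedMonomial f) (n : ℕ) :
    IsSignedMonomial (f ^ n) := by
  induction n with
  | zero => simpa using isSignedMonomial_one
  | succ n ih => exact pow_succ f n ▸ ih.mul hf

theorem IsSignedMonomial.zpow {f : RationalFun σ} (hf : IsSignedMonomial f) (n : ℤ) :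
    IsSignedMonomial (f ^ n) := by
  cases n with
  | ofNat n => simpa using hf.pow n
  | negSucc n => simpa using (hf.pow (n + 1)).inv

theorem IsSignedMonomial.prod {ι : Type*} {s : Finset ι} {f : ι → RationalFun σ}
    (hf : ∀ i ∈ s, IsSignedMonomial (f i)) : IsSignedMonomial (∏ i ∈ s, f i) := by
  classical
  induction s using Finset.induction_on with
  | empty => simpa using isSignedMonomial_one
  | insert i s hi ih =>
    rw [Finset.prod_insert hi]
    exact (hf i (by simp)).mul (ih fun j hj => hf j (by simp [hj]))

theorem IsSignedMonomial.isSelfReciprocal {f g : RationalFun σ} (hg : IsSignedMonomial g)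
    (h : recip f = g * f) : IsSelfReciprocal f := by
  obtain ⟨ε, β, rfl⟩ := hg
  exact ⟨ε, β, h⟩

theorem one_sub_var_mul_var_ne_zero (i j : σ) : 1 - var i * var j ≠ 0 := by
  have h : (1 : MvPolynomial σ ℝ) - MvPolynomial.X i * MvPolynomial.X j ≠ 0 := by
    intro h
    simpa using congrArg MvPolynomial.constantCoeff h
  have h1 := (map_ne_zero_iff (algebraMap (MvPolynomial σ ℝ) (RationalFun σ))
    (IsFractionRing.injective _ _)).mpr h
  simpa [var] using h1

theorem var_sub_var_ne_zero {i j : σ} (h : i ≠ j) : var i - var j ≠ 0 :=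
  sub_ne_zero.mpr (var_injective.ne h)

end RationalFun

open RationalFun

theorem PolygonClass.isSignedMonomial_factor (c : PolygonClass) (m : ℕ) :
    IsSignedMonomial (c.factor m) := by
  have hv := fun v : StepVar => isSignedMonomial_var v
  cases c
  · exact (((isSignedMonomial_neg_one.pow m).mul ((hv _).zpow _)).div (hv _)).mul
      (.prod fun i _ => hv _)
  · exact (((hv _).zpow _).div (hv _)).neg.mul (.prod fun i _ => (hv _).mul (hv _))
  · exact (IsSignedMonomial.prod fun i _ => (hv _).mul (hv _)).neg
  · exact (isSignedMonomial_neg_one.pow m).div ((hv _).mul (hv _))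
  · exact (isSignedMonomial_one.div ((hv _).mul (hv _))).neg

namespace PolygonClass

/-! ### Reciprocity of the sums over codes -/

section Reciprocity

variable {c : PolygonClass} {ι : Type} [Fintype ι] {x : ι → StepVar} {b : ι → RationalFun StepVar}
  {m n : ℕ}

/-- The sum of `b i * t / (1 - t)`, where `t` is the product of `y₀` and the `i`-th base. -/
def ratSum (x : ι → StepVar) (b : ι → RationalFun StepVar) : RationalFun StepVar :=
  ∑ i, b i * (var (.yt 0) * var (x i) / (1 - var (.yt 0) * var (x i)))

theorem algebraMap_tsum_codeWeight
    (hV : ∀ h : ℕ, 1 ≤ h → algebraMap _ (SeriesField StepVar) (movesSum (c.letter m) n 1 h) =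
        ∑ i, expand StepVar (b i) *
          algebraMap _ _ ((MvPowerSeries.X (x i) : MvPowerSeries StepVar ℝ) ^ h)) :
    algebraMap _ (SeriesField StepVar) (∑' a, codeWeight (c.letter m) n a) =
      expand StepVar (ratSum x b) := by
  have hy : c.letter m (.yt 0) = MvPowerSeries.X (.yt 0) := if_pos trivial
  have hcc : ∀ i, (MvPowerSeries.X (.yt 0) * MvPowerSeries.X (x i) :
      MvPowerSeries StepVar ℝ).constantCoeff = 0 := fun i => by simp
  have h1 := hasSum_tsum_codeWeight (constantCoeff_letter (c := c) (m := m)) n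
  have hS : ∀ i, HasSum (fun h : ℕ => c.letter m (.yt 0) ^ (h + 1) *
      (MvPowerSeries.X (x i) : MvPowerSeries StepVar ℝ) ^ (h + 1))
      ((∑' n : ℕ, (MvPowerSeries.X (.yt 0) * MvPowerSeries.X (x i)) ^ n) *
        (MvPowerSeries.X (.yt 0) * MvPowerSeries.X (x i))) := fun i => by
    refine (hasSum_iff_of_eq fun h => ?_).mpr (hasSum_geometric_mul (hcc i) _)
    rw [hy]
    ring
  rw [← h1.tsum_eq]
  have h2 := tsum_mul_expSum (V := fun h : ℕ => movesSum (c.letter m) n 1 h) hV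
    (u := fun h : ℕ => c.letter m (.yt 0) ^ (h + 1)) (N := fun h => h + 1)
    (fun _ _ => Nat.succ_le_succ (Nat.zero_le _)) h1.summable hS
  rw [h2, ratSum, map_sum]
  refine Finset.sum_congr rfl fun i _ => ?_
  have h3 := expand_geometric (var (.yt 0) * var (x i)) (hcc i)
    (by rw [map_mul, map_mul, expand_var, expand_var])
  rw [map_mul, h3, map_mul, ← expand_var, ← expand_var, ← map_mul, ← map_mul, ← map_mul,
    div_mul_eq_mul_div, one_mul]

theorem recip_geometric (v u : StepVar) :
    recip (var v * var u / (1 - var v * var u)) = -(1 / (1 - var v * var u)) := by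
  have h := one_sub_var_mul_var_ne_zero v u
  have hv := var_ne_zero v
  have hu := var_ne_zero u
  simp only [map_div₀, map_sub, map_mul, map_one, recip_var]
  rw [one_sub_inv_mul_inv hv hu]
  field_simp

/-- The factor `var (x i)` supplied by `b i` restores the numerator that `t / (1 - t) ↦ -1 / (1 -
t)` has lost, so all summands get the same monomial. -/
theorem recip_ratSum_of_homogeneous {M : RationalFun StepVar}
    (hb : ∀ i, recip (b i) = M * (var (x i) / var (.yb m)) * b i) :
    recip (ratSum x b) = -(M / (var (.yt 0) * var (.yb m))) * ratSum x b := by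
  rw [ratSum, map_sum, Finset.mul_sum]
  refine Finset.sum_congr rfl fun i _ => ?_
  rw [map_mul, hb, recip_geometric]
  have h := one_sub_var_mul_var_ne_zero (StepVar.yt 0) (x i)
  have h0 := var_ne_zero (StepVar.yt 0)
  have hm := var_ne_zero (StepVar.yb m)
  field_simp

/-- Since `t / (1 - t) = 1 / (1 - t) - 1` and the `b i` add up to 0, the numerator lost under
inversion does not matter. -/
theorem recip_ratSum_of_sum_eq_zero {M : RationalFun StepVar}
    (hb : ∀ i, recip (b i) = M * b i) (hb0 : ∑ i, b i = 0) :
    recip (ratSum x b) = -M * ratSum x b := by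
  have h1 : ratSum x b = ∑ i, b i * (1 / (1 - var (.yt 0) * var (x i))) := by
    rw [← sub_eq_zero, ratSum, ← Finset.sum_sub_distrib, ← neg_eq_zero, ← hb0,
      ← Finset.sum_neg_distrib]
    refine Finset.sum_congr rfl fun i _ => ?_
    have h := one_sub_var_mul_var_ne_zero (StepVar.yt 0) (x i)
    field_simp
    ring
  conv_rhs => rw [h1]
  rw [ratSum, map_sum, Finset.mul_sum]
  refine Finset.sum_congr rfl fun i _ => ?_
  rw [map_mul, hb, recip_geometric]
  ring

end Reciprocity

/-- Reciprocity, if the transfer operator is homogeneous. -/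
theorem exists_reciprocal_of_homogeneous (c : PolygonClass) (n : ℕ)
    (μ : ℕ → RationalFun StepVar)
    (hmain : ∀ k x, 1 ≤ k → k < n + 1 → c.IsBase (n + 1) (k + 1) x →
      recip (c.mainAt (n + 1) k x) = μ k * c.mainAt (n + 1) k x)
    (htop : ∀ k x, 1 ≤ k → k < n + 1 → c.IsBase (n + 1) (k + 1) x → c.Allowed (n + 1) (.zt k) →
      recip (c.topAt (n + 1) k x) * var x = μ k * var (.zt k) * c.topAt (n + 1) k x)
    (hbot : ∀ k x, 1 ≤ k → k < n + 1 → c.IsBase (n + 1) (k + 1) x → c.Allowed (n + 1) (.yb k) →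
      recip (c.botAt (n + 1) k x) * var x = μ k * var (.yb k) * c.botAt (n + 1) k x) :
    ∃ f : RationalFun StepVar,
      algebraMap _ (SeriesField StepVar) (∑' a, codeWeight (c.letter (n + 1)) n a) =
        expand StepVar f ∧
      recip f = -((∏ j ∈ Finset.Ico 1 (n + 1), μ j) / (var (.yt 0) * var (.yb (n + 1)))) * f := by
  have hexp := exists_expSum c (n + 1) μ (fun v : StepVar => var v / var (StepVar.yb (n + 1)))
  obtain ⟨ι, _, x, b, -, hb, hV, -⟩ := hexp (div_self (var_ne_zero _)) hmain
    (fun k x h1 h2 h3 h4 => by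
      rw [← mul_div_assoc, htop k x h1 h2 h3 h4, mul_div_assoc', div_mul_eq_mul_div])
    (fun k x h1 h2 h3 h4 => by
      rw [← mul_div_assoc, hbot k x h1 h2 h3 h4, mul_div_assoc', div_mul_eq_mul_div])
    n 1 le_rfl (by omega)
  exact ⟨ratSum x b, algebraMap_tsum_codeWeight hV, recip_ratSum_of_homogeneous hb⟩

/-- With all letters present every step has multiplier 1, so the factor comes from the first column
and the last climb alone. -/
theorem exists_reciprocal_columnConvex (n : ℕ) :
    ∃ f : RationalFun StepVar,
      algebraMap _ (SeriesField StepVar) (∑' a, codeWeight (columnConvex.letter (n + 1)) n a) =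
        expand StepVar f ∧
      recip f = columnConvex.factor (n + 1) * f := by
  have hall : ∀ v, columnConvex.ratLetter (n + 1) v = var v := fun v =>
    ratLetter_of_allowed (by cases v <;> simp [Allowed])
  have hyz : ∀ k, var (StepVar.yb k) - var (.zt k) ≠ 0 := fun k => var_sub_var_ne_zero (by simp)
  obtain ⟨f, hf, hr⟩ := exists_reciprocal_of_homogeneous columnConvex n (fun _ => 1)
    (fun k x _ hk hx => by
      rw [recip_mainAt, mainAt, one_mul]
      simp only [hall]
      exact coeffMain_inv_columnConvex (var_ne_zero _) (var_ne_zero _) (var_ne_zero _)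
        (var_ne_zero _) (var_ne_zero _) (one_sub_var_mul_var_ne_zero _ _)
        (one_sub_var_mul_var_ne_zero _ _) (var_sub_var_ne_zero (hx.ne_yb hk))
        (var_sub_var_ne_zero hx.ne_zt))
    (fun k x _ hk hx _ => by
      rw [recip_topAt, topAt, one_mul]
      simp only [hall]
      exact coeffTop_inv_columnConvex (var_ne_zero _) (var_ne_zero _) (var_ne_zero _)
        (var_ne_zero _) (one_sub_var_mul_var_ne_zero _ _) (var_sub_var_ne_zero (hx.ne_yb hk))
        (var_sub_var_ne_zero hx.ne_zt) (hyz k))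
    (fun k x _ hk hx _ => by
      rw [recip_botAt, botAt, one_mul]
      simp only [hall]
      exact coeffBot_inv_columnConvex (var_ne_zero _) (var_ne_zero _) (var_ne_zero _)
        (var_ne_zero _) (one_sub_var_mul_var_ne_zero _ _) (var_sub_var_ne_zero (hx.ne_yb hk))
        (hyz k))
  exact ⟨f, hf, by rw [hr, Finset.prod_const_one]; rfl⟩

/-- Each of the `m - 1` inner abscissas contributes -1, and the sum over the first column one more
sign. -/
theorem exists_reciprocal_barGraph (n : ℕ) :
    ∃ f : RationalFun StepVar,
      algebraMap _ (SeriesField StepVar) (∑' a, codeWeight (barGraph.letter (n + 1)) n a) =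
        expand StepVar f ∧
      recip f = barGraph.factor (n + 1) * f := by
  have ht : ∀ k, barGraph.ratLetter (n + 1) (.yt k) = var (.yt k) := fun k =>
    ratLetter_of_allowed trivial
  have hz : ∀ k, barGraph.ratLetter (n + 1) (.zt k) = var (.zt k) := fun k =>
    ratLetter_of_allowed (by simp [Allowed])
  have hy : ∀ k, k < n + 1 → barGraph.ratLetter (n + 1) (.yb k) = 0 := fun k hk =>
    ratLetter_of_not_allowed (by simp [Allowed, hk.ne])
  have hw : ∀ k, barGraph.ratLetter (n + 1) (.zb k) = 0 := fun k =>
    ratLetter_of_not_allowed (by simp [Allowed])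
  obtain ⟨f, hf, hr⟩ := exists_reciprocal_of_homogeneous barGraph n (fun _ => -1)
    (fun k x _ hk hx => by
      rw [recip_mainAt, mainAt, ht, hz, hy k hk, hw, inv_zero]
      exact coeffMain_inv_barGraph (var_ne_zero _) (var_ne_zero _) (var_ne_zero _)
        (one_sub_var_mul_var_ne_zero _ _) (var_sub_var_ne_zero hx.ne_zt))
    (fun k x _ hk hx _ => by
      rw [recip_topAt, topAt, hz, hy k hk, hw, inv_zero]
      exact coeffTop_inv_barGraph (var_ne_zero _) (var_ne_zero _) (var_sub_var_ne_zero hx.ne_zt))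
    (fun k x _ hk hx h => by simp [Allowed, hk.ne] at h)
  refine ⟨f, hf, ?_⟩
  rw [hr, Finset.prod_const, Nat.card_Ico, factor]
  simp only [Nat.add_sub_cancel, pow_succ]
  ring

/-- In these two classes a step creates no new base. The multiplier of a step, which involves the
base, is therefore the same for all summands. -/
theorem IsBase.eq_yb {c : PolygonClass} {m k : ℕ} {v : StepVar} (h : c.IsBase m k v)
    (hc : c = .ferrers ∨ c = .stack) : v = .yb m := by
  rcases h with h | ⟨j, _, hj, rfl | rfl, ha⟩
  · exact h
  · rcases hc with rfl | rfl <;> simp [Allowed] at ha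
  · rcases hc with rfl | rfl <;> simp [Allowed, hj.ne] at ha

theorem exists_reciprocal_stack (n : ℕ) :
    ∃ f : RationalFun StepVar,
      algebraMap _ (SeriesField StepVar) (∑' a, codeWeight (stack.letter (n + 1)) n a) =
        expand StepVar f ∧
      recip f = stack.factor (n + 1) * f := by
  have ht : ∀ k, stack.ratLetter (n + 1) (.yt k) = var (.yt k) := fun k =>
    ratLetter_of_allowed trivial
  have hz : ∀ k, stack.ratLetter (n + 1) (.zt k) = 0 := fun k =>
    ratLetter_of_not_allowed (by simp [Allowed])
  have hy : ∀ k, k < n + 1 → stack.ratLetter (n + 1) (.yb k) = 0 := fun k hk =>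
    ratLetter_of_not_allowed (by simp [Allowed, hk.ne])
  have hw : ∀ k, stack.ratLetter (n + 1) (.zb k) = var (.zb k) := fun k =>
    ratLetter_of_allowed (by simp [Allowed])
  obtain ⟨f, hf, hr⟩ := exists_reciprocal_of_homogeneous stack n
    (fun k => var (.yb (n + 1)) ^ 2 * (var (.yt k) * var (.zb k)))
    (fun k x _ hk hx => by
      obtain rfl := hx.eq_yb (Or.inr rfl)
      rw [recip_mainAt, mainAt, ht, hz, hy k hk, hw, inv_zero]
      exact coeffMain_inv_stack (var_ne_zero _) (var_ne_zero _) (var_ne_zero _)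
        (one_sub_var_mul_var_ne_zero _ _))
    (fun k x _ hk hx h => by simp [Allowed] at h)
    (fun k x _ hk hx h => by simp [Allowed, hk.ne] at h)
  refine ⟨f, hf, ?_⟩
  rw [hr, Finset.prod_mul_distrib, Finset.prod_const, Nat.card_Ico, factor]
  have h0 := var_ne_zero (StepVar.yb (n + 1))
  -- The `n = m - 1` factors `y_m ^ 2`, divided once by `y_m`, give the exponent `2m - 3`; it is -1
  -- for `m = 1`, hence the integer powers.
  have he : 2 * ((n + 1 : ℕ) : ℤ) - 3 = ((2 * n : ℕ) : ℤ) - 1 := by push_cast; ring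
  rw [he, zpow_sub_one₀ h0, zpow_natCast]
  simp only [Nat.add_sub_cancel, pow_mul]
  field_simp

theorem exists_reciprocal_ferrers (n : ℕ) :
    ∃ f : RationalFun StepVar,
      algebraMap _ (SeriesField StepVar) (∑' a, codeWeight (ferrers.letter (n + 1)) n a) =
        expand StepVar f ∧
      recip f = ferrers.factor (n + 1) * f := by
  have ht : ∀ k, ferrers.ratLetter (n + 1) (.yt k) = var (.yt k) := fun k =>
    ratLetter_of_allowed trivial
  have hz : ∀ k, ferrers.ratLetter (n + 1) (.zt k) = 0 := fun k =>
    ratLetter_of_not_allowed (by simp [Allowed])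
  have hy : ∀ k, k < n + 1 → ferrers.ratLetter (n + 1) (.yb k) = 0 := fun k hk =>
    ratLetter_of_not_allowed (by simp [Allowed, hk.ne])
  have hw : ∀ k, ferrers.ratLetter (n + 1) (.zb k) = 0 := fun k =>
    ratLetter_of_not_allowed (by simp [Allowed])
  obtain ⟨f, hf, hr⟩ := exists_reciprocal_of_homogeneous ferrers n
    (fun k => -var (.yb (n + 1)) * var (.yt k))
    (fun k x _ hk hx => by
      obtain rfl := hx.eq_yb (Or.inl rfl)
      rw [recip_mainAt, mainAt, ht, hz, hy k hk, hw, inv_zero]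
      exact coeffMain_inv_ferrers (var_ne_zero _) (var_ne_zero _))
    (fun k x _ hk hx h => by simp [Allowed] at h)
    (fun k x _ hk hx h => by simp [Allowed, hk.ne] at h)
  refine ⟨f, hf, ?_⟩
  rw [hr, Finset.prod_mul_distrib, Finset.prod_const, Nat.card_Ico, factor]
  have h0 := var_ne_zero (StepVar.yb (n + 1))
  have he : ((n + 1 : ℕ) : ℤ) - 2 = (n : ℤ) - 1 := by push_cast; ring
  rw [he, zpow_sub_one₀ h0, zpow_natCast, pow_succ, neg_pow]
  simp only [Nat.add_sub_cancel]
  field_simp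

theorem exists_reciprocal_staircase (n : ℕ) :
    ∃ f : RationalFun StepVar,
      algebraMap _ (SeriesField StepVar) (∑' a, codeWeight (staircase.letter (n + 1)) n a) =
        expand StepVar f ∧
      IsSelfReciprocal f ∧ (2 ≤ n + 1 → recip f = staircase.factor (n + 1) * f) := by
  rcases Nat.eq_zero_or_pos n with rfl | hn
  -- For `m = 1` no transfer step occurs and the coefficients do not cancel. The rectangles of width
  -- 1 are self-reciprocal with the factor `-1 / (y_0 y_m)` instead.
  · obtain ⟨f, hf, hr⟩ := exists_reciprocal_of_homogeneous staircase 0 (fun _ => 1)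
      (fun k x _ _ => by omega) (fun k x _ _ => by omega) (fun k x _ _ => by omega)
    refine ⟨f, hf, IsSignedMonomial.isSelfReciprocal ?_ hr, by omega⟩
    rw [Finset.prod_const_one]
    exact (isSignedMonomial_one.div ((isSignedMonomial_var _).mul (isSignedMonomial_var _))).neg
  have ht : ∀ k, staircase.ratLetter (n + 1) (.yt k) = var (.yt k) := fun k =>
    ratLetter_of_allowed trivial
  have hz : ∀ k, staircase.ratLetter (n + 1) (.zt k) = 0 := fun k =>
    ratLetter_of_not_allowed (by simp [Allowed])
  have hy : ∀ k, staircase.ratLetter (n + 1) (.yb k) = var (.yb k) := fun k =>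
    ratLetter_of_allowed (by simp [Allowed])
  have hw : ∀ k, staircase.ratLetter (n + 1) (.zb k) = 0 := fun k =>
    ratLetter_of_not_allowed (by simp [Allowed])
  -- Main and bottom coefficients have the same multiplier, independent of the base, so the gauge is
  -- trivial.
  obtain ⟨ι, _, x, b, -, hb, hV, hb0⟩ := exists_expSum staircase (n + 1)
    (fun k => var (.yb k) * var (.yt k)) (fun _ => 1) rfl
    (fun k x _ hk hx => by
      rw [recip_mainAt, mainAt, ht, hz, hy, hw, inv_zero]
      exact coeffMain_inv_staircase (var_ne_zero _) (var_ne_zero _) (var_ne_zero _)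
        (var_sub_var_ne_zero (hx.ne_yb hk)))
    (fun k x _ hk hx h => by simp [Allowed] at h)
    (fun k x _ hk hx _ => by
      rw [recip_botAt, botAt, ht, hz, hy, inv_zero, mul_one, mul_one]
      exact coeffBot_inv_staircase (var_ne_zero _) (var_ne_zero _) (var_ne_zero _)
        (var_sub_var_ne_zero (hx.ne_yb hk)))
    n 1 le_rfl (by omega)
  have hr := recip_ratSum_of_sum_eq_zero (x := x) (fun i => by rw [hb, mul_one])
    (hb0 hn fun k x _ _ => ⟨by simp [Allowed], by simp [Allowed], by
      rw [mainAt, botAt, ht, hz, hy, hw]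
      exact coeffMain_add_coeffBot_staircase⟩)
  exact ⟨ratSum x b, algebraMap_tsum_codeWeight hV,
    (isSignedMonomial_factor staircase (n + 1)).isSelfReciprocal hr, fun _ => hr⟩

theorem exists_reciprocal (c : PolygonClass) (n : ℕ) :
    ∃ f : RationalFun StepVar,
      algebraMap _ (SeriesField StepVar) (∑' a, codeWeight (c.letter (n + 1)) n a) =
        expand StepVar f ∧
      IsSelfReciprocal f ∧ ((c = .staircase → 2 ≤ n + 1) → recip f = c.factor (n + 1) * f) := by
  have key : ∀ f, recip f = c.factor (n + 1) * f → IsSelfReciprocal f := fun f hf =>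
    (isSignedMonomial_factor c (n + 1)).isSelfReciprocal hf
  cases c
  case ferrers =>
    obtain ⟨f, hf, hr⟩ := exists_reciprocal_ferrers n
    exact ⟨f, hf, key f hr, fun _ => hr⟩
  case stack =>
    obtain ⟨f, hf, hr⟩ := exists_reciprocal_stack n
    exact ⟨f, hf, key f hr, fun _ => hr⟩
  case staircase =>
    obtain ⟨f, hf, hs, hr⟩ := exists_reciprocal_staircase n
    exact ⟨f, hf, hs, fun h => hr (h rfl)⟩
  case barGraph =>
    obtain ⟨f, hf, hr⟩ := exists_reciprocal_barGraph n
    exact ⟨f, hf, key f hr, fun _ => hr⟩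
  case columnConvex =>
    obtain ⟨f, hf, hr⟩ := exists_reciprocal_columnConvex n
    exact ⟨f, hf, key f hr, fun _ => hr⟩

end PolygonClass

end

/-! ### Words of lattice paths -/

section Paths

theorem pathEnd_append (p : ℤ × ℤ) (l l' : List LatticeStep) :
    pathEnd p (l ++ l') = pathEnd (pathEnd p l) l' := by
  induction l generalizing p with
  | nil => rfl
  | cons s l ih => exact ih _

theorem pathSteps_append (p : ℤ × ℤ) (l l' : List LatticeStep) :
    pathSteps p (l ++ l') = pathSteps p l ++ pathSteps (pathEnd p l) l' := by
  induction l generalizing p with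
  | nil => rfl
  | cons s l ih => simp [pathSteps, pathEnd, ih]

theorem pathSites_append_cons (p : ℤ × ℤ) (l : List LatticeStep) (s : LatticeStep)
    (l' : List LatticeStep) :
    pathSites p (l ++ s :: l') = pathSites p l ++ pathSites (pathEnd p l + s.vec) l' := by
  induction l generalizing p with
  | nil => rfl
  | cons s l ih => simp [pathSites, pathEnd, ih]

theorem start_mem_pathSites (p : ℤ × ℤ) (l : List LatticeStep) : p ∈ pathSites p l := by
  cases l <;> simp [pathSites]

theorem pathEnd_mem_pathSites (p : ℤ × ℤ) (l : List LatticeStep) :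
    pathEnd p l ∈ pathSites p l := by
  induction l generalizing p with
  | nil => simp [pathSites, pathEnd]
  | cons s l ih => exact List.mem_cons_of_mem _ (ih _)

theorem start_fst_le {p v : ℤ × ℤ} {l : List LatticeStep} (h : v ∈ pathSites p l) :
    p.1 ≤ v.1 := by
  induction l generalizing p with
  | nil => simp_all [pathSites]
  | cons s l ih =>
    rcases List.mem_cons.mp h with rfl | h
    · exact le_rfl
    · refine le_trans ?_ (ih h)
      cases s <;> simp [LatticeStep.vec]

/-- The vertical run with displacement `d`. -/
def verticalRun (d : ℤ) : List LatticeStep :=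
  List.replicate d.toNat .N ++ List.replicate (-d).toNat .S

theorem verticalRun_of_nonneg {d : ℤ} (h : 0 ≤ d) :
    verticalRun d = List.replicate d.toNat .N := by
  rw [verticalRun, show (-d).toNat = 0 by omega]
  simp

theorem verticalRun_of_nonpos {d : ℤ} (h : d ≤ 0) :
    verticalRun d = List.replicate (-d).toNat .S := by
  rw [verticalRun, show d.toNat = 0 by omega]
  simp

theorem pathEnd_replicate_N (p : ℤ × ℤ) (n : ℕ) :
    pathEnd p (List.replicate n .N) = (p.1, p.2 + n) := by
  induction n generalizing p with
  | zero => simp [pathEnd]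
  | succ n ih =>
    rw [List.replicate_succ, pathEnd, ih]
    ext
    · simp [LatticeStep.vec]
    · simp [LatticeStep.vec]
      ring

theorem pathEnd_replicate_S (p : ℤ × ℤ) (n : ℕ) :
    pathEnd p (List.replicate n .S) = (p.1, p.2 - n) := by
  induction n generalizing p with
  | zero => simp [pathEnd]
  | succ n ih =>
    rw [List.replicate_succ, pathEnd, ih]
    ext
    · simp [LatticeStep.vec]
    · simp [LatticeStep.vec]
      ring

theorem mem_pathSites_replicate_N {p v : ℤ × ℤ} {n : ℕ} :
    v ∈ pathSites p (List.replicate n .N) ↔ v.1 = p.1 ∧ p.2 ≤ v.2 ∧ v.2 ≤ p.2 + n := by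
  induction n generalizing p with
  | zero =>
    simp only [List.replicate_zero, pathSites, List.mem_singleton, Prod.ext_iff]
    omega
  | succ n ih =>
    simp only [List.replicate_succ, pathSites, List.mem_cons, ih, Prod.ext_iff, LatticeStep.vec,
      Prod.fst_add, Prod.snd_add]
    push_cast
    omega

theorem mem_pathSites_replicate_S {p v : ℤ × ℤ} {n : ℕ} :
    v ∈ pathSites p (List.replicate n .S) ↔ v.1 = p.1 ∧ p.2 - n ≤ v.2 ∧ v.2 ≤ p.2 := by
  induction n generalizing p with
  | zero =>
    simp only [List.replicate_zero, pathSites, List.mem_singleton, Prod.ext_iff]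
    omega
  | succ n ih =>
    simp only [List.replicate_succ, pathSites, List.mem_cons, ih, Prod.ext_iff, LatticeStep.vec,
      Prod.fst_add, Prod.snd_add]
    push_cast
    omega

theorem nodup_pathSites_replicate_N (p : ℤ × ℤ) (n : ℕ) :
    (pathSites p (List.replicate n .N)).Nodup := by
  induction n generalizing p with
  | zero => simp [pathSites]
  | succ n ih =>
    refine List.nodup_cons.mpr ⟨fun h => ?_, ih _⟩
    have := (mem_pathSites_replicate_N.mp h).2.1
    simp [LatticeStep.vec] at this

theorem nodup_pathSites_replicate_S (p : ℤ × ℤ) (n : ℕ) :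
    (pathSites p (List.replicate n .S)).Nodup := by
  induction n generalizing p with
  | zero => simp [pathSites]
  | succ n ih =>
    refine List.nodup_cons.mpr ⟨fun h => ?_, ih _⟩
    have := (mem_pathSites_replicate_S.mp h).2.2
    simp [LatticeStep.vec] at this

theorem pathEnd_verticalRun (p : ℤ × ℤ) (d : ℤ) : pathEnd p (verticalRun d) = (p.1, p.2 + d) := by
  rcases le_total 0 d with h | h
  · rw [verticalRun_of_nonneg h, pathEnd_replicate_N, Int.toNat_of_nonneg h]
  · rw [verticalRun_of_nonpos h, pathEnd_replicate_S, Int.toNat_of_nonneg (by omega)]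
    simp

theorem mem_pathSites_verticalRun {p v : ℤ × ℤ} {d : ℤ} :
    v ∈ pathSites p (verticalRun d) ↔ v.1 = p.1 ∧ v.2 ∈ Set.uIcc p.2 (p.2 + d) := by
  rw [Set.mem_uIcc]
  rcases le_total 0 d with h | h
  · rw [verticalRun_of_nonneg h, mem_pathSites_replicate_N]
    omega
  · rw [verticalRun_of_nonpos h, mem_pathSites_replicate_S]
    omega

theorem nodup_pathSites_verticalRun (p : ℤ × ℤ) (d : ℤ) :
    (pathSites p (verticalRun d)).Nodup := by
  rcases le_total 0 d with h | h
  · rw [verticalRun_of_nonneg h]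
    exact nodup_pathSites_replicate_N _ _
  · rw [verticalRun_of_nonpos h]
    exact nodup_pathSites_replicate_S _ _

/-- The path with `m` east steps whose vertical displacement at the `i`-th abscissa is `T i`. -/
def pathWord : (ℕ → ℤ) → ℕ → List LatticeStep
  | T, 0 => verticalRun (T 0)
  | T, m + 1 => verticalRun (T 0) ++ .E :: pathWord (fun i => T (i + 1)) m

/-- The ordinate at which a path, started at height `0`, arrives at the `i`-th abscissa. -/
def ordinate (T : ℕ → ℤ) (i : ℕ) : ℤ := ∑ j ∈ Finset.range i, T j

theorem ordinate_zero (T : ℕ → ℤ) : ordinate T 0 = 0 := Finset.sum_range_zero T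

theorem ordinate_succ (T : ℕ → ℤ) (i : ℕ) : ordinate T (i + 1) = ordinate T i + T i :=
  Finset.sum_range_succ T i

theorem ordinate_one (T : ℕ → ℤ) : ordinate T 1 = T 0 := Finset.sum_range_one T

theorem ordinate_succ' (T : ℕ → ℤ) (i : ℕ) :
    ordinate T (i + 1) = T 0 + ordinate (fun j => T (j + 1)) i := by
  rw [ordinate, Finset.sum_range_succ', add_comm]
  rfl

theorem pathWord_congr {T T' : ℕ → ℤ} {m : ℕ} (h : ∀ i ≤ m, T i = T' i) :
    pathWord T m = pathWord T' m := by
  induction m generalizing T T' with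
  | zero => rw [pathWord, pathWord, h 0 le_rfl]
  | succ m ih =>
    rw [pathWord, pathWord, h 0 (Nat.zero_le _), ih fun i hi => h (i + 1) (by omega)]

theorem pathEnd_pathWord (p : ℤ × ℤ) (T : ℕ → ℤ) (m : ℕ) :
    pathEnd p (pathWord T m) = (p.1 + m, p.2 + ordinate T (m + 1)) := by
  induction m generalizing T p with
  | zero => simp [pathWord, pathEnd_verticalRun, ordinate_one]
  | succ m ih =>
    rw [pathWord, pathEnd_append, pathEnd_verticalRun, pathEnd, ih, ordinate_succ' T]
    ext <;> simp [LatticeStep.vec] <;> ring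

theorem mem_pathSites_pathWord {p v : ℤ × ℤ} {T : ℕ → ℤ} {m : ℕ} :
    v ∈ pathSites p (pathWord T m) ↔ ∃ i ≤ m, v.1 = p.1 + i ∧
      v.2 ∈ Set.uIcc (p.2 + ordinate T i) (p.2 + ordinate T (i + 1)) := by
  induction m generalizing T p with
  | zero => simp [pathWord, mem_pathSites_verticalRun, ordinate_one, ordinate_zero]
  | succ m ih =>
    rw [pathWord, pathSites_append_cons, List.mem_append, mem_pathSites_verticalRun,
      pathEnd_verticalRun, ih]
    constructor
    · rintro (⟨h1, h2⟩ | ⟨i, hi, h1, h2⟩)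
      · exact ⟨0, Nat.zero_le _, by simpa using h1, by simpa [ordinate_one, ordinate_zero] using h2⟩
      · refine ⟨i + 1, by omega, ?_, ?_⟩
        · rw [h1]
          simp [LatticeStep.vec]
          ring
        · rw [ordinate_succ' T, ordinate_succ' T]
          simpa [LatticeStep.vec, add_assoc] using h2
    · rintro ⟨i, hi, h1, h2⟩
      cases i with
      | zero =>
        exact Or.inl ⟨by simpa using h1, by simpa [ordinate_one, ordinate_zero] using h2⟩
      | succ i =>
        refine Or.inr ⟨i, by omega, ?_, ?_⟩
        · rw [h1]
          simp [LatticeStep.vec]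
          ring
        · rw [ordinate_succ' T, ordinate_succ' T] at h2
          simpa [LatticeStep.vec, add_assoc] using h2

theorem nodup_pathSites_pathWord (p : ℤ × ℤ) (T : ℕ → ℤ) (m : ℕ) :
    (pathSites p (pathWord T m)).Nodup := by
  induction m generalizing T p with
  | zero => exact nodup_pathSites_verticalRun _ _
  | succ m ih =>
    rw [pathWord, pathSites_append_cons]
    refine List.Nodup.append (nodup_pathSites_verticalRun _ _) (ih _ _) fun v hv hv' => ?_
    have h1 := (mem_pathSites_verticalRun.mp hv).1
    have h2 := start_fst_le hv'
    rw [pathEnd_verticalRun] at h2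
    simp [LatticeStep.vec] at h2
    omega

theorem length_pathWord (T : ℕ → ℤ) (m : ℕ) :
    ((pathWord T m).length : ℤ) = m + ∑ i ∈ Finset.range (m + 1), |T i| := by
  have h : ∀ d : ℤ, ((verticalRun d).length : ℤ) = |d| := fun d => by
    rcases le_total 0 d with h | h
    · rw [verticalRun_of_nonneg h, List.length_replicate, Int.toNat_of_nonneg h, abs_of_nonneg h]
    · rw [verticalRun_of_nonpos h, List.length_replicate, Int.toNat_of_nonneg (by omega),
        abs_of_nonpos h]
  induction m generalizing T with
  | zero => simp [pathWord, h]
  | succ m ih =>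
    rw [Finset.sum_range_succ', pathWord, List.length_append, List.length_cons]
    push_cast
    rw [h, ih]
    ring

theorem east_mem_pathSteps_pathWord {p v : ℤ × ℤ} {T : ℕ → ℤ} {m : ℕ} :
    (v, LatticeStep.E) ∈ pathSteps p (pathWord T m) ↔
      ∃ i < m, v = (p.1 + i, p.2 + ordinate T (i + 1)) := by
  have hrun : ∀ (p : ℤ × ℤ) (d : ℤ), (v, LatticeStep.E) ∉ pathSteps p (verticalRun d) := by
    have h : ∀ (l : List LatticeStep) (p : ℤ × ℤ), LatticeStep.E ∉ l →
        (v, LatticeStep.E) ∉ pathSteps p l := by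
      intro l
      induction l with
      | nil => simp [pathSteps]
      | cons s l ih =>
        intro p hp
        simp only [List.mem_cons, not_or] at hp
        simp only [pathSteps, List.mem_cons, Prod.mk.injEq, not_or]
        exact ⟨fun h => hp.1 h.2, ih _ hp.2⟩
    intro p d
    exact h _ _ (by simp [verticalRun, List.mem_replicate])
  induction m generalizing T p with
  | zero => simp [pathWord, hrun]
  | succ m ih =>
    rw [pathWord, pathSteps_append, List.mem_append, pathEnd_verticalRun, pathSteps, List.mem_cons]
    simp only [ih, hrun, false_or, Prod.mk.injEq, and_true]
    constructor
    · rintro (h | ⟨i, hi, h⟩)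
      · exact ⟨0, by omega, by simpa [ordinate_one] using h⟩
      · refine ⟨i + 1, by omega, ?_⟩
        rw [h, ordinate_succ' T (i + 1)]
        ext <;> simp [LatticeStep.vec] <;> ring
    · rintro ⟨i, hi, h⟩
      cases i with
      | zero => exact Or.inl (by simpa [ordinate_one] using h)
      | succ i =>
        refine Or.inr ⟨i, by omega, ?_⟩
        rw [h, ordinate_succ' T (i + 1)]
        ext <;> simp [LatticeStep.vec] <;> ring

/-- The number of steps of type `s` at abscissa `i` of a path that starts at `p`. -/
def stepsFrom (p : ℤ × ℤ) (l : List LatticeStep) (s : LatticeStep) (i : ℤ) : ℕ :=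
  (pathSteps p l).countP (fun a => a.1.1 = i ∧ a.2 = s)

theorem stepsFrom_append (p : ℤ × ℤ) (l l' : List LatticeStep) (s : LatticeStep) (i : ℤ) :
    stepsFrom p (l ++ l') s i = stepsFrom p l s i + stepsFrom (pathEnd p l) l' s i := by
  rw [stepsFrom, pathSteps_append, List.countP_append]
  rfl

theorem stepsFrom_cons (p : ℤ × ℤ) (t : LatticeStep) (l : List LatticeStep) (s : LatticeStep)
    (i : ℤ) : stepsFrom p (t :: l) s i =
      stepsFrom (p + t.vec) l s i + if p.1 = i ∧ t = s then 1 else 0 := by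
  rw [stepsFrom, pathSteps, List.countP_cons]
  simp [stepsFrom]

theorem stepsFrom_eq_zero_of_lt {p : ℤ × ℤ} {i : ℤ} (h : i < p.1) (l : List LatticeStep)
    (s : LatticeStep) : stepsFrom p l s i = 0 := by
  induction l generalizing p with
  | nil => rfl
  | cons t l ih =>
    rw [stepsFrom_cons, ih, if_neg (by omega)]
    refine lt_of_lt_of_le h ?_
    cases t <;> simp [LatticeStep.vec]

theorem stepsFrom_replicate {t : LatticeStep} (ht : t.vec.1 = 0) (p : ℤ × ℤ) (n : ℕ)
    (s : LatticeStep) (i : ℤ) :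
    stepsFrom p (List.replicate n t) s i = if p.1 = i ∧ t = s then n else 0 := by
  induction n generalizing p with
  | zero => simp [stepsFrom, pathSteps]
  | succ n ih =>
    rw [List.replicate_succ, stepsFrom_cons, ih]
    simp only [Prod.fst_add, ht, add_zero]
    split_ifs <;> rfl

theorem stepsFrom_verticalRun (p : ℤ × ℤ) (d : ℤ) (i : ℤ) :
    stepsFrom p (verticalRun d) .N i = (if p.1 = i then d.toNat else 0) ∧
      stepsFrom p (verticalRun d) .S i = if p.1 = i then (-d).toNat else 0 := by
  have hN := stepsFrom_replicate (t := .N) rfl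
  have hS := stepsFrom_replicate (t := .S) rfl
  rw [verticalRun]
  simp [stepsFrom_append, hN, hS, pathEnd_replicate_N]

theorem stepsFrom_pathWord (p : ℤ × ℤ) (T : ℕ → ℤ) {m i : ℕ} (hi : i ≤ m) :
    stepsFrom p (pathWord T m) .N (p.1 + i) = (T i).toNat ∧
      stepsFrom p (pathWord T m) .S (p.1 + i) = (-T i).toNat := by
  induction m generalizing T p i with
  | zero =>
    obtain rfl : i = 0 := by omega
    simp [pathWord, stepsFrom_verticalRun]
  | succ m ih =>
    rw [pathWord, stepsFrom_append, stepsFrom_append, pathEnd_verticalRun, stepsFrom_cons,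
      stepsFrom_cons, (stepsFrom_verticalRun _ _ _).1, (stepsFrom_verticalRun _ _ _).2]
    cases i with
    | zero =>
      rw [stepsFrom_eq_zero_of_lt (by simp [LatticeStep.vec]),
        stepsFrom_eq_zero_of_lt (by simp [LatticeStep.vec])]
      simp
    | succ i =>
      have h := ih ((p.1, p.2 + T 0) + LatticeStep.E.vec) (fun i => T (i + 1)) (i := i) (by omega)
      have h1 : ((p.1, p.2 + T 0) + LatticeStep.E.vec).1 + (i : ℤ) = p.1 + ((i + 1 : ℕ) : ℤ) := by
        simp [LatticeStep.vec]
        ring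
      rw [h1] at h
      have hne : ¬ p.1 = p.1 + ((i + 1 : ℕ) : ℤ) := by omega
      rw [h.1, h.2]
      simp only [hne, false_and, if_false, zero_add, add_zero, and_self]

theorem stepsAt_pathWord (T : ℕ → ℤ) {m i : ℕ} (hi : i ≤ m) :
    stepsAt (pathWord T m) .N i = (T i).toNat ∧ stepsAt (pathWord T m) .S i = (-T i).toNat := by
  have h := stepsFrom_pathWord (0, 0) T hi
  rw [zero_add] at h
  exact h

/-- The vertical displacement of a path at abscissa `i`. -/
def displacement (l : List LatticeStep) (i : ℕ) : ℤ := stepsAt l .N i - stepsAt l .S i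

theorem displacement_pathWord (T : ℕ → ℤ) {m i : ℕ} (hi : i ≤ m) :
    displacement (pathWord T m) i = T i := by
  rw [displacement, (stepsAt_pathWord T hi).1, (stepsAt_pathWord T hi).2]
  omega

/-- Without west steps, self-avoidance says that no north step is adjacent to a south step; thus
each vertical run is monotone and determined by its displacement. -/
theorem exists_eq_pathWord {p : ℤ × ℤ} {l : List LatticeStep} {m : ℕ}
    (hl : (pathSites p l).Nodup) (hm : (pathEnd p l).1 = p.1 + m) : ∃ T, l = pathWord T m := by
  induction l generalizing p m with
  | nil =>
    obtain rfl : m = 0 := by simpa [pathEnd] using hm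
    exact ⟨0, by simp [pathWord, verticalRun]⟩
  | cons s l ih =>
    have hl' := (List.nodup_cons.mp hl)
    have hback : ∀ t l', l = t :: l' → s.vec + t.vec ≠ 0 := by
      rintro t l' rfl h
      apply hl'.1
      have : p ∈ pathSites (p + s.vec + t.vec) l' := by
        rw [add_assoc, h, add_zero]
        exact start_mem_pathSites _ _
      exact List.mem_cons_of_mem _ this
    have hupd : ∀ (T : ℕ → ℤ) (a : ℤ), verticalRun a = s :: verticalRun (T 0) →
        pathWord (Function.update T 0 a) m = s :: pathWord T m := by
      intro T a ha
      cases m <;> simp [pathWord, ha, Function.update]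
    cases s with
    | N =>
      obtain ⟨T, rfl⟩ := ih hl'.2 (m := m) (by rw [← pathEnd, hm]; simp [LatticeStep.vec])
      refine ⟨Function.update T 0 (T 0 + 1), (hupd T _ ?_).symm⟩
      have h0 : 0 ≤ T 0 := by
        by_contra h
        obtain ⟨k, hk⟩ : ∃ k : ℕ, (-T 0).toNat = k + 1 := ⟨(-T 0).toNat - 1, by omega⟩
        have hr : verticalRun (T 0) = .S :: List.replicate k .S := by
          rw [verticalRun_of_nonpos (by omega), hk, List.replicate_succ]
        cases m with
        | zero => exact hback .S _ hr rfl
        | succ m => exact hback .S _ (by rw [pathWord, hr]; rfl) rfl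
      rw [verticalRun_of_nonneg h0, verticalRun_of_nonneg (by omega),
        show (T 0 + 1).toNat = (T 0).toNat + 1 by omega, List.replicate_succ]
    | S =>
      obtain ⟨T, rfl⟩ := ih hl'.2 (m := m) (by rw [← pathEnd, hm]; simp [LatticeStep.vec])
      refine ⟨Function.update T 0 (T 0 - 1), (hupd T _ ?_).symm⟩
      have h0 : T 0 ≤ 0 := by
        by_contra h
        obtain ⟨k, hk⟩ : ∃ k : ℕ, (T 0).toNat = k + 1 := ⟨(T 0).toNat - 1, by omega⟩
        have hr : verticalRun (T 0) = .N :: List.replicate k .N := by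
          rw [verticalRun_of_nonneg (by omega), hk, List.replicate_succ]
        cases m with
        | zero => exact hback .N _ hr rfl
        | succ m => exact hback .N _ (by rw [pathWord, hr]; rfl) rfl
      rw [verticalRun_of_nonpos h0, verticalRun_of_nonpos (by omega),
        show (-(T 0 - 1)).toNat = (-T 0).toNat + 1 by omega, List.replicate_succ]
    | E =>
      have h1 := start_fst_le (pathEnd_mem_pathSites (p + LatticeStep.E.vec) l)
      rw [← pathEnd, hm] at h1
      obtain ⟨m, rfl⟩ : ∃ k, m = k + 1 := ⟨m - 1, by simp [LatticeStep.vec] at h1; omega⟩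
      obtain ⟨T, rfl⟩ := ih hl'.2 (m := m) (by
        rw [← pathEnd, hm]
        simp [LatticeStep.vec]
        ring)
      -- A leading east step means an empty run at the first abscissa.
      exact ⟨fun i => Nat.casesOn i 0 T, by simp [pathWord, verticalRun]⟩

theorem eq_pathWord_displacement {l : List LatticeStep} {m : ℕ}
    (hl : (pathSites (0, 0) l).Nodup) (hm : (pathEnd (0, 0) l).1 = m) :
    l = pathWord (displacement l) m := by
  obtain ⟨T, rfl⟩ := exists_eq_pathWord (m := m) hl (by simpa using hm)
  exact pathWord_congr fun i hi => (displacement_pathWord T hi).symm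

end Paths

/-! ### Polygons and their moves -/

/-- Disjoint intervals with `c < a` lie entirely one above the other; comparing their end points
gives the three inequalities of `Admissible`. -/
theorem lt_and_admissible_of_disjoint_uIcc {a b c d : ℤ} (hca : c < a)
    (h : ∀ v, v ∈ Set.uIcc a b → v ∉ Set.uIcc c d) : Admissible (a - c) (b - a) (d - c) := by
  -- If the intervals meet, the larger of their lower ends is a common point.
  have h1 := h (max (min a b) (min c d))
  simp only [Set.mem_uIcc] at h1
  unfold Admissible
  omega

theorem disjoint_uIcc_of_admissible {a b c d v : ℤ} (hca : c < a)
    (h : Admissible (a - c) (b - a) (d - c)) (hv : v ∈ Set.uIcc a b) : v ∉ Set.uIcc c d := by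
  simp only [Set.mem_uIcc] at *
  unfold Admissible at h
  omega

/-- The moves of the two sides of a polygon of width `m`: `T` of the top path and `B` of the bottom
path. -/
structure IsPolygonMoves (m : ℕ) (T B : ℕ → ℤ) : Prop where
  top_zero : 0 < T 0
  top_last : T m = 0
  bot_zero : B 0 = 0
  end_eq : ordinate T (m + 1) = ordinate B (m + 1)
  admissible : ∀ i, 1 ≤ i → i < m → Admissible (ordinate T i - ordinate B i) (T i) (B i)

namespace IsPolygonMoves

variable {m : ℕ} {T B : ℕ → ℤ}

theorem ordinate_lt (h : IsPolygonMoves m T B) {i : ℕ} (hi : 1 ≤ i) (him : i ≤ m) :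
    ordinate B i < ordinate T i := by
  induction i, hi using Nat.le_induction with
  | base =>
    rw [ordinate_one, ordinate_one, h.bot_zero]
    exact h.top_zero
  | succ i hi ih =>
    have := (h.admissible i hi (by omega)).pos
    rw [ordinate_succ, ordinate_succ]
    omega

theorem disjoint (h : IsPolygonMoves m T B) {i : ℕ} (hi : 1 ≤ i) (him : i < m) {v : ℤ}
    (hv : v ∈ Set.uIcc (ordinate T i) (ordinate T (i + 1))) :
    v ∉ Set.uIcc (ordinate B i) (ordinate B (i + 1)) := by
  refine disjoint_uIcc_of_admissible (h.ordinate_lt hi him.le) ?_ hv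
  have := h.admissible i hi him
  rwa [ordinate_succ, ordinate_succ, add_sub_cancel_left, add_sub_cancel_left]

theorem top_end (h : IsPolygonMoves m T B) : ordinate T (m + 1) = ordinate T m := by
  rw [ordinate_succ, h.top_last, add_zero]

theorem bot_last (h : IsPolygonMoves m T B) : B m = ordinate T m - ordinate B m := by
  have := h.end_eq
  rw [h.top_end, ordinate_succ] at this
  omega

/-- The polygon with given moves. -/
def toPolygon (h : IsPolygonMoves m T B) (hm : 1 ≤ m) : ColumnConvexPolygon m where
  top := pathWord T m
  bot := pathWord B m
  end_eq := by rw [pathEnd_pathWord, pathEnd_pathWord, h.end_eq]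
  width_eq := by simp [pathEnd_pathWord]
  top_nodup := nodup_pathSites_pathWord _ _ _
  bot_nodup := nodup_pathSites_pathWord _ _ _
  meet := by
    intro v hv hv'
    obtain ⟨i, hi, hi1, hi2⟩ := mem_pathSites_pathWord.mp hv
    obtain ⟨j, hj, hj1, hj2⟩ := mem_pathSites_pathWord.mp hv'
    obtain rfl : i = j := by omega
    simp only [zero_add] at hi1 hi2 hj2
    rcases Nat.eq_zero_or_pos i with rfl | hpos
    · left
      rw [ordinate_zero, ordinate_one, h.bot_zero, Set.uIcc_self] at hj2
      exact Prod.ext (by simpa using hi1) hj2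
    · rcases hi.lt_or_eq with hlt | rfl
      · exact absurd hj2 (h.disjoint hpos hlt hi2)
      · right
        rw [h.top_end, Set.uIcc_self] at hi2
        rw [pathEnd_pathWord, h.top_end]
        exact Prod.ext (by simpa using hi1) (by simpa using hi2)
  top_ne_bot := by
    intro he
    have h1 := displacement_pathWord T (Nat.zero_le m)
    rw [he, displacement_pathWord B (Nat.zero_le m), h.bot_zero] at h1
    exact h.top_zero.ne h1
  top_S_zero := by
    rw [(stepsAt_pathWord T (Nat.zero_le m)).2]
    have := h.top_zero
    omega
  bot_N_zero := by rw [(stepsAt_pathWord B (Nat.zero_le m)).1, h.bot_zero]; rfl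
  bot_S_zero := by rw [(stepsAt_pathWord B (Nat.zero_le m)).2, h.bot_zero]; rfl
  top_N_last := by rw [(stepsAt_pathWord T le_rfl).1, h.top_last]; rfl
  top_S_last := by rw [(stepsAt_pathWord T le_rfl).2, h.top_last]; rfl
  bot_S_last := by
    rw [(stepsAt_pathWord B le_rfl).2, h.bot_last]
    have := h.ordinate_lt hm le_rfl
    omega

end IsPolygonMoves

namespace ColumnConvexPolygon

variable {m : ℕ} (P : ColumnConvexPolygon m)

/-- The moves of the top path. -/
def topMove : ℕ → ℤ := displacement P.top

/-- The moves of the bottom path. -/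
def botMove : ℕ → ℤ := displacement P.bot

theorem top_eq : P.top = pathWord P.topMove m :=
  eq_pathWord_displacement P.top_nodup P.width_eq

theorem bot_eq : P.bot = pathWord P.botMove m :=
  eq_pathWord_displacement P.bot_nodup (P.end_eq ▸ P.width_eq)

theorem stepsAt_top {i : ℕ} (hi : i ≤ m) :
    stepsAt P.top .N i = (P.topMove i).toNat ∧ stepsAt P.top .S i = (-P.topMove i).toNat := by
  rw [P.top_eq]
  exact stepsAt_pathWord _ hi

theorem stepsAt_bot {i : ℕ} (hi : i ≤ m) :
    stepsAt P.bot .N i = (P.botMove i).toNat ∧ stepsAt P.bot .S i = (-P.botMove i).toNat := by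
  rw [P.bot_eq]
  exact stepsAt_pathWord _ hi

theorem isPolygonMoves (hm : 1 ≤ m) : IsPolygonMoves m P.topMove P.botMove := by
  have hT0 : 0 ≤ P.topMove 0 := by
    simp only [topMove, displacement, P.top_S_zero]
    omega
  have hTm : P.topMove m = 0 := by
    simp only [topMove, displacement, P.top_S_last, P.top_N_last]
    omega
  have hB0 : P.botMove 0 = 0 := by
    simp only [botMove, displacement, P.bot_S_zero, P.bot_N_zero]
    omega
  have hend : ordinate P.topMove (m + 1) = ordinate P.botMove (m + 1) := by
    have h := P.end_eq
    rw [P.top_eq, P.bot_eq, pathEnd_pathWord, pathEnd_pathWord] at h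
    simpa using congrArg Prod.snd h
  have hmeet : ∀ i, 1 ≤ i → i < m → ∀ v,
      v ∈ Set.uIcc (ordinate P.topMove i) (ordinate P.topMove (i + 1)) →
      v ∉ Set.uIcc (ordinate P.botMove i) (ordinate P.botMove (i + 1)) := by
    intro i hi him v hv hv'
    have h1 : ((i : ℤ), v) ∈ pathSites (0, 0) P.top := by
      rw [P.top_eq]
      exact mem_pathSites_pathWord.mpr ⟨i, him.le, by simp, by simpa using hv⟩
    have h2 : ((i : ℤ), v) ∈ pathSites (0, 0) P.bot := by
      rw [P.bot_eq]
      exact mem_pathSites_pathWord.mpr ⟨i, him.le, by simp, by simpa using hv'⟩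
    rcases P.meet _ h1 h2 with h | h
    · have := congrArg Prod.fst h
      simp only at this
      omega
    · have := congrArg Prod.fst h
      rw [P.width_eq] at this
      simp only at this
      omega
  have hpos : 0 < P.topMove 0 := by
    -- If the first column had height 0, both paths would pass through `(1, 0)`: a forbidden meeting
    -- for `m > 1`, and coinciding paths for `m = 1`.
    refine lt_of_le_of_ne hT0 fun h0 => ?_
    rcases hm.eq_or_lt with rfl | hlt
    · apply P.top_ne_bot
      rw [P.top_eq, P.bot_eq]
      refine pathWord_congr fun i hi => ?_
      have h1 : P.botMove 1 = 0 := by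
        simp only [ordinate_succ, ordinate_zero] at hend
        omega
      interval_cases i
      · rw [← h0, hB0]
      · rw [hTm, h1]
    · refine hmeet 1 le_rfl hlt 0 ?_ ?_
      · rw [ordinate_one, ← h0]
        exact Set.left_mem_uIcc
      · rw [ordinate_one, hB0]
        exact Set.left_mem_uIcc
  have hadm : ∀ i, 1 ≤ i → i < m → ordinate P.botMove i < ordinate P.topMove i →
      Admissible (ordinate P.topMove i - ordinate P.botMove i) (P.topMove i) (P.botMove i) := by
    intro i hi him hlt
    have := lt_and_admissible_of_disjoint_uIcc hlt (hmeet i hi him)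
    rwa [ordinate_succ, ordinate_succ, add_sub_cancel_left, add_sub_cancel_left] at this
  have hlt : ∀ i, 1 ≤ i → i ≤ m → ordinate P.botMove i < ordinate P.topMove i := by
    intro i hi
    induction i, hi using Nat.le_induction with
    | base =>
      intro _
      rw [ordinate_one, ordinate_one, hB0]
      exact hpos
    | succ i hi ih =>
      intro him
      have := (hadm i hi (by omega) (ih (by omega))).pos
      rw [ordinate_succ, ordinate_succ]
      omega
  exact ⟨hpos, hTm, hB0, hend, fun i hi him => hadm i hi him (hlt i hi him.le)⟩

/-- The code of a polygon: the height of its first column and the moves of its sides. -/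
def code {n : ℕ} (P : ColumnConvexPolygon (n + 1)) : ℤ × (Fin n → ℤ × ℤ) :=
  (P.topMove 0, fun i => (P.topMove (1 + i), P.botMove (1 + i)))

/-- The moves absent from the code are forced: the top path is level at the last abscissa, the
bottom path at the first, and its last climb is the height of the last column. -/
theorem code_injective (n : ℕ) :
    Function.Injective (code : ColumnConvexPolygon (n + 1) → ℤ × (Fin n → ℤ × ℤ)) := by
  intro P Q h
  have hP := P.isPolygonMoves (by omega)
  have hQ := Q.isPolygonMoves (by omega)
  have h0 : P.topMove 0 = Q.topMove 0 := congrArg Prod.fst h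
  have h1 : ∀ i, 1 ≤ i → i < n + 1 → P.topMove i = Q.topMove i ∧ P.botMove i = Q.botMove i := by
    intro i hi hin
    have := congrFun (congrArg Prod.snd h) ⟨i - 1, by omega⟩
    simp only [code, Prod.mk.injEq] at this
    rwa [show 1 + (i - 1) = i by omega] at this
  have hT : ∀ i ≤ n + 1, P.topMove i = Q.topMove i := by
    intro i hi
    rcases Nat.eq_zero_or_pos i with rfl | hpos
    · exact h0
    · rcases hi.lt_or_eq with hlt | rfl
      · exact (h1 i hpos hlt).1
      · rw [hP.top_last, hQ.top_last]
  have hB' : ∀ i < n + 1, P.botMove i = Q.botMove i := by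
    intro i hi
    rcases Nat.eq_zero_or_pos i with rfl | hpos
    · rw [hP.bot_zero, hQ.bot_zero]
    · exact (h1 i hpos hi).2
  have hB : ∀ i ≤ n + 1, P.botMove i = Q.botMove i := by
    intro i hi
    rcases hi.lt_or_eq with hlt | rfl
    · exact hB' i hlt
    · rw [hP.bot_last, hQ.bot_last]
      congr 1
      · exact Finset.sum_congr rfl fun i hi => hT i (Finset.mem_range.mp hi).le
      · exact Finset.sum_congr rfl fun i hi => hB' i (Finset.mem_range.mp hi)
  ext1
  · rw [P.top_eq, Q.top_eq]
    exact pathWord_congr hT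
  · rw [P.bot_eq, Q.bot_eq]
    exact pathWord_congr hB

end ColumnConvexPolygon

/-! ### The weight of a code -/

noncomputable section

variable {σ : Type*}

theorem movesWeight_of_admissible (ω : StepVar → MvPowerSeries σ ℝ) (T B : ℕ → ℤ) (n k : ℕ)
    (h : ∀ i, k ≤ i → i < k + n → Admissible (ordinate T i - ordinate B i) (T i) (B i)) :
    movesWeight ω n k (ordinate T k - ordinate B k) (fun i => (T (k + i), B (k + i))) =
      (∏ i ∈ Finset.Ico k (k + n), (runWeight (ω (.yt i)) (ω (.zt i)) (T i) *
        runWeight (ω (.yb i)) (ω (.zb i)) (B i))) *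
      ω (.yb (k + n)) ^ (ordinate T (k + n) - ordinate B (k + n)).toNat := by
  induction n generalizing k with
  | zero => simp [movesWeight]
  | succ n ih =>
    have h1 := ih (k + 1) fun i hi hin => h i (by omega) (by omega)
    have h2 : ordinate T k - ordinate B k + T k - B k =
        ordinate T (k + 1) - ordinate B (k + 1) := by
      rw [ordinate_succ, ordinate_succ]
      ring
    have h3 : Fin.tail (fun i : Fin (n + 1) => (T (k + i), B (k + i))) =
        fun i : Fin n => (T (k + 1 + i), B (k + 1 + i)) := by
      funext i
      simp only [Fin.tail, Fin.val_succ]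
      rw [show k + ((i : ℕ) + 1) = k + 1 + i by omega]
    rw [movesWeight, h3]
    simp only [Fin.val_zero, add_zero]
    rw [h2, h1, moveWeight, if_pos (h k le_rfl (by omega)),
      Finset.prod_eq_prod_Ico_succ_bot (show k < k + (n + 1) by omega),
      show k + 1 + n = k + (n + 1) by omega]
    ring

theorem admissible_of_movesWeight_ne_zero {ω : StepVar → MvPowerSeries σ ℝ} {T B : ℕ → ℤ}
    {n k : ℕ} (h : movesWeight ω n k (ordinate T k - ordinate B k)
      (fun i => (T (k + i), B (k + i))) ≠ 0) (i : ℕ) (hi : k ≤ i) (hin : i < k + n) :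
    Admissible (ordinate T i - ordinate B i) (T i) (B i) := by
  induction n generalizing k with
  | zero => omega
  | succ n ih =>
    have h2 : ordinate T k - ordinate B k + T k - B k =
        ordinate T (k + 1) - ordinate B (k + 1) := by
      rw [ordinate_succ, ordinate_succ]
      ring
    have h3 : Fin.tail (fun i : Fin (n + 1) => (T (k + i), B (k + i))) =
        fun i : Fin n => (T (k + 1 + i), B (k + 1 + i)) := by
      funext i
      simp only [Fin.tail, Fin.val_succ]
      rw [show k + ((i : ℕ) + 1) = k + 1 + i by omega]
    rw [movesWeight, h3] at h
    simp only [Fin.val_zero, add_zero] at h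
    rw [h2] at h
    rcases hi.eq_or_lt with rfl | hlt
    · by_contra H
      exact h (by rw [moveWeight, if_neg H, zero_mul])
    · exact ih (right_ne_zero_of_mul h) (by omega) (by omega)

/-- A code of nonzero weight has a positive first height and only admissible moves, and such data
can be completed to a polygon. -/
theorem codeWeight_eq_zero_of_notMem_range {n : ℕ} (ω : StepVar → MvPowerSeries σ ℝ)
    {a : ℤ × (Fin n → ℤ × ℤ)}
    (ha : a ∉ Set.range (ColumnConvexPolygon.code : ColumnConvexPolygon (n + 1) → _)) :
    codeWeight ω n a = 0 := by
  obtain ⟨h, d⟩ := a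
  by_contra hne
  apply ha
  rw [codeWeight] at hne
  simp only at hne
  split_ifs at hne with hpos
  · let T : ℕ → ℤ := fun i => if i = 0 then h else
      if hi : i - 1 < n then (d ⟨i - 1, hi⟩).1 else 0
    let B' : ℕ → ℤ := fun i => if i = 0 then 0 else
      if hi : i - 1 < n then (d ⟨i - 1, hi⟩).2 else 0
    -- The last bottom move closes the polygon. The auxiliary `B'` avoids a circular definition, as
    -- it agrees with `B` before that abscissa.
    let B : ℕ → ℤ := fun i => if i = n + 1 then ordinate T i - ordinate B' i else B' i
    have hT0 : T 0 = h := rfl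
    have hTm : T (n + 1) = 0 := by simp [T]
    have hB0 : B 0 = 0 := by simp [B, B']
    have hBord : ∀ i, i ≤ n + 1 → ordinate B i = ordinate B' i := fun i hi =>
      Finset.sum_congr rfl fun j hj => if_neg (by have := Finset.mem_range.mp hj; omega)
    have hd : d = fun i : Fin n => (T (1 + i), B (1 + i)) := by
      funext i
      have h1 : ¬ (1 + (i : ℕ) = n + 1) := by omega
      have h2 : ¬ (1 + (i : ℕ) = 0) := by omega
      simp [T, B, B', h1]
    have hh : h = ordinate T 1 - ordinate B 1 := by
      rw [ordinate_one, ordinate_one, hB0, hT0, sub_zero]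
    have hend : ordinate T (n + 1 + 1) = ordinate B (n + 1 + 1) := by
      rw [ordinate_succ T (n + 1), ordinate_succ B (n + 1), hTm, hBord _ le_rfl]
      simp [B]
    have hne' := right_ne_zero_of_mul hne
    rw [hd, hh] at hne'
    have hpm : IsPolygonMoves (n + 1) T B := ⟨hpos, hTm, hB0, hend, fun i hi hin =>
      admissible_of_movesWeight_ne_zero hne' i hi (by omega)⟩
    refine ⟨hpm.toPolygon (by omega), Prod.ext ?_ ?_⟩
    · exact displacement_pathWord T (Nat.zero_le _)
    · refine Eq.trans ?_ hd.symm
      funext i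
      exact Prod.ext (displacement_pathWord T (by omega)) (displacement_pathWord B (by omega))
  · exact (hne rfl).elim

theorem codeWeight_code {n : ℕ} (ω : StepVar → MvPowerSeries σ ℝ)
    (P : ColumnConvexPolygon (n + 1)) :
    codeWeight ω n P.code = ∏ i ∈ Finset.range (n + 1 + 1),
      (ω (.yt i) ^ stepsAt P.top .N i * ω (.zt i) ^ stepsAt P.top .S i *
        ω (.yb i) ^ stepsAt P.bot .N i * ω (.zb i) ^ stepsAt P.bot .S i) := by
  have hP := P.isPolygonMoves (by omega)
  have h1 : P.topMove 0 = ordinate P.topMove 1 - ordinate P.botMove 1 := by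
    rw [ordinate_one, ordinate_one, hP.bot_zero, sub_zero]
  have h2 := movesWeight_of_admissible ω P.topMove P.botMove n 1
    fun i hi hin => hP.admissible i hi (by omega)
  rw [← h1] at h2
  rw [codeWeight, if_pos (by exact hP.top_zero)]
  simp only [ColumnConvexPolygon.code]
  rw [h2, Finset.range_eq_Ico, Finset.prod_eq_prod_Ico_succ_bot (show 0 < n + 1 + 1 by omega),
    Finset.prod_Ico_succ_top (show 0 + 1 ≤ n + 1 by omega), (P.stepsAt_top (Nat.zero_le _)).1,
    P.top_S_zero, P.bot_N_zero, P.bot_S_zero, P.top_N_last, P.top_S_last, P.bot_S_last,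
    (P.stepsAt_bot le_rfl).1, hP.bot_last, add_comm 1 n, zero_add]
  simp only [pow_zero, mul_one, one_mul]
  congr 2
  refine Finset.prod_congr rfl fun i hi => ?_
  have hi' : i ≤ n + 1 := by
    have := Finset.mem_Ico.mp hi
    omega
  rw [(P.stepsAt_top hi').1, (P.stepsAt_top hi').2, (P.stepsAt_bot hi').1, (P.stepsAt_bot hi').2,
    runWeight, runWeight]
  ring

end

/-! ### The classes in terms of the moves -/

namespace ColumnConvexPolygon

variable {m : ℕ} {P : ColumnConvexPolygon m}

theorem mem_sites {v : ℤ × ℤ} : v ∈ P.sites ↔ ∃ i ≤ m, v.1 = i ∧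
    (v.2 ∈ Set.uIcc (ordinate P.topMove i) (ordinate P.topMove (i + 1)) ∨
      v.2 ∈ Set.uIcc (ordinate P.botMove i) (ordinate P.botMove (i + 1))) := by
  rw [sites, List.mem_toFinset, List.mem_append, P.top_eq, P.bot_eq, mem_pathSites_pathWord,
    mem_pathSites_pathWord]
  simp only [zero_add]
  constructor
  · rintro (⟨i, hi, h1, h2⟩ | ⟨i, hi, h1, h2⟩)
    · exact ⟨i, hi, h1, Or.inl h2⟩
    · exact ⟨i, hi, h1, Or.inr h2⟩
  · rintro ⟨i, hi, h1, h2 | h2⟩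
    · exact Or.inl ⟨i, hi, h1, h2⟩
    · exact Or.inr ⟨i, hi, h1, h2⟩

theorem yMin_le {v : ℤ × ℤ} (h : v ∈ P.sites) : P.yMin ≤ v.2 := Finset.inf'_le _ h

theorem le_yMax {v : ℤ × ℤ} (h : v ∈ P.sites) : v.2 ≤ P.yMax := Finset.le_sup' _ h

theorem ordinate_top_mem (P : ColumnConvexPolygon m) {i : ℕ} (hi : i ≤ m) :
    ((i : ℤ), ordinate P.topMove i) ∈ P.sites :=
  mem_sites.mpr ⟨i, hi, rfl, Or.inl Set.left_mem_uIcc⟩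

theorem ordinate_top_succ_mem (P : ColumnConvexPolygon m) {i : ℕ} (hi : i ≤ m) :
    ((i : ℤ), ordinate P.topMove (i + 1)) ∈ P.sites :=
  mem_sites.mpr ⟨i, hi, rfl, Or.inl Set.right_mem_uIcc⟩

theorem ordinate_bot_mem (P : ColumnConvexPolygon m) {i : ℕ} (hi : i ≤ m) :
    ((i : ℤ), ordinate P.botMove i) ∈ P.sites :=
  mem_sites.mpr ⟨i, hi, rfl, Or.inr Set.left_mem_uIcc⟩

theorem ordinate_bot_succ_mem (P : ColumnConvexPolygon m) {i : ℕ} (hi : i ≤ m) :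
    ((i : ℤ), ordinate P.botMove (i + 1)) ∈ P.sites :=
  mem_sites.mpr ⟨i, hi, rfl, Or.inr Set.right_mem_uIcc⟩

/-- If the ordinates of both paths lie between two bounds that are attained, these are the extreme
ordinates of the polygon. -/
theorem yMin_eq_of_bounds {a : ℤ} (hT : ∀ i ≤ m + 1, a ≤ ordinate P.topMove i)
    (hB : ∀ i ≤ m + 1, a ≤ ordinate P.botMove i) {x : ℤ} (ha : (x, a) ∈ P.sites) :
    P.yMin = a := by
  refine le_antisymm (yMin_le ha) (Finset.le_inf' _ _ fun v hv => ?_)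
  obtain ⟨i, hi, -, h | h⟩ := mem_sites.mp hv
  · have h1 := hT i (by omega)
    have h2 := hT (i + 1) (by omega)
    rw [Set.mem_uIcc] at h
    omega
  · have h1 := hB i (by omega)
    have h2 := hB (i + 1) (by omega)
    rw [Set.mem_uIcc] at h
    omega

theorem yMax_eq_of_bounds {a : ℤ} (hT : ∀ i ≤ m + 1, ordinate P.topMove i ≤ a)
    (hB : ∀ i ≤ m + 1, ordinate P.botMove i ≤ a) {x : ℤ} (ha : (x, a) ∈ P.sites) :
    P.yMax = a := by
  refine le_antisymm (Finset.sup'_le _ _ fun v hv => ?_) (le_yMax ha)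
  obtain ⟨i, hi, -, h | h⟩ := mem_sites.mp hv
  · have h1 := hT i (by omega)
    have h2 := hT (i + 1) (by omega)
    rw [Set.mem_uIcc] at h
    omega
  · have h1 := hB i (by omega)
    have h2 := hB (i + 1) (by omega)
    rw [Set.mem_uIcc] at h
    omega

theorem perimeter_eq (P : ColumnConvexPolygon m) : (P.perimeter : ℤ) =
    2 * m + ∑ i ∈ Finset.range (m + 1), |P.topMove i| +
      ∑ i ∈ Finset.range (m + 1), |P.botMove i| := by
  have h1 := length_pathWord P.topMove m
  have h2 := length_pathWord P.botMove m
  rw [← P.top_eq] at h1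
  rw [← P.bot_eq] at h2
  rw [perimeter]
  push_cast
  rw [h1, h2]
  ring

end ColumnConvexPolygon

/-- Total variation is net rise plus twice the total descent. A perimeter equal to that of the
bounding rectangle then forces the descents to vanish. -/
theorem sum_abs_eq (T : ℕ → ℤ) (k : ℕ) : ∑ i ∈ Finset.range k, |T i| =
    ordinate T k + 2 * ∑ i ∈ Finset.range k, max (-T i) 0 := by
  rw [ordinate, Finset.mul_sum, ← Finset.sum_add_distrib]
  refine Finset.sum_congr rfl fun i _ => ?_
  rcases le_total 0 (T i) with h | h
  · rw [abs_of_nonneg h, max_eq_right (by omega)]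
    ring
  · rw [abs_of_nonpos h, max_eq_left (by omega)]
    ring

theorem sum_abs_eq' (T : ℕ → ℤ) (k : ℕ) : ∑ i ∈ Finset.range k, |T i| =
    -ordinate T k + 2 * ∑ i ∈ Finset.range k, max (T i) 0 := by
  rw [ordinate, Finset.mul_sum, ← Finset.sum_neg_distrib, ← Finset.sum_add_distrib]
  refine Finset.sum_congr rfl fun i _ => ?_
  rcases le_total 0 (T i) with h | h
  · rw [abs_of_nonneg h, max_eq_left h]
    ring
  · rw [abs_of_nonpos h, max_eq_right h]
    ring

theorem ordinate_le_of_nonneg {T : ℕ → ℤ} {i k : ℕ} (hik : i ≤ k)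
    (h : ∀ j, i ≤ j → j < k → 0 ≤ T j) : ordinate T i ≤ ordinate T k := by
  induction k, hik using Nat.le_induction with
  | base => exact le_rfl
  | succ k hik ih =>
    rw [ordinate_succ]
    have h1 := h k hik (by omega)
    have h2 := ih fun j hj hjk => h j hj (by omega)
    omega

theorem ordinate_le_of_nonpos {T : ℕ → ℤ} {i k : ℕ} (hik : i ≤ k)
    (h : ∀ j, i ≤ j → j < k → T j ≤ 0) : ordinate T k ≤ ordinate T i := by
  induction k, hik using Nat.le_induction with
  | base => exact le_rfl
  | succ k hik ih =>
    rw [ordinate_succ]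
    have h1 := h k hik (by omega)
    have h2 := ih fun j hj hjk => h j hj (by omega)
    omega

namespace ColumnConvexPolygon

variable {m : ℕ} {P : ColumnConvexPolygon m}

/-- On the line of abscissa `m` the polygon extends only up to the common end point of the two
paths. -/
theorem yMax_of_hasNE (hm : 1 ≤ m) (h : P.HasNE) : P.yMax = ordinate P.topMove (m + 1) := by
  have hP := P.isPolygonMoves hm
  have h0 := hP.ordinate_lt hm le_rfl
  obtain ⟨i, hi, hi1, hi2⟩ := mem_sites.mp h
  obtain rfl : m = i := by simpa using hi1
  have h1 := le_yMax (P.ordinate_top_succ_mem le_rfl)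
  rw [hP.top_end, ← hP.end_eq, hP.top_end, Set.mem_uIcc, Set.mem_uIcc] at hi2
  rw [hP.top_end] at h1 ⊢
  simp only at h1 hi2
  omega

theorem yMin_of_hasSE (hm : 1 ≤ m) (h : P.HasSE) : P.yMin = ordinate P.botMove m := by
  have hP := P.isPolygonMoves hm
  have h0 := hP.ordinate_lt hm le_rfl
  obtain ⟨i, hi, hi1, hi2⟩ := mem_sites.mp h
  obtain rfl : m = i := by simpa using hi1
  have h1 := yMin_le (P.ordinate_bot_mem le_rfl)
  rw [hP.top_end, ← hP.end_eq, hP.top_end, Set.mem_uIcc, Set.mem_uIcc] at hi2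
  simp only at h1 hi2
  omega

theorem yMin_of_hasSW (hm : 1 ≤ m) (h : P.HasSW) : P.yMin = 0 := by
  have hP := P.isPolygonMoves hm
  obtain ⟨i, hi, hi1, hi2⟩ := mem_sites.mp h
  obtain rfl : i = 0 := by simpa using hi1.symm
  have h1 := yMin_le (P.ordinate_bot_mem (Nat.zero_le _))
  have h2 := hP.top_zero
  rw [ordinate_zero, ordinate_zero, ordinate_one, ordinate_one, hP.bot_zero, Set.mem_uIcc,
    Set.mem_uIcc] at hi2
  rw [ordinate_zero] at h1
  simp only at h1 hi2
  omega

/-- Given the two corners, both paths rise from the bottom to the top of the rectangle; the excess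
of the perimeter is twice the total descent of both. -/
theorem staircase_mem_iff (hm : 1 ≤ m) : PolygonClass.staircase.Mem P ↔
    (∀ i ≤ m, 0 ≤ P.topMove i) ∧ ∀ i ≤ m, 0 ≤ P.botMove i := by
  have hP := P.isPolygonMoves hm
  constructor
  · rintro ⟨hc, hsw, hne⟩
    rw [IsConvex, perimeter_eq, yMax_of_hasNE hm hne, yMin_of_hasSW hm hsw, sum_abs_eq, sum_abs_eq,
      ← hP.end_eq] at hc
    have h1 : 0 ≤ ∑ i ∈ Finset.range (m + 1), max (-P.topMove i) 0 :=
      Finset.sum_nonneg fun i _ => le_max_right _ _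
    have h2 : 0 ≤ ∑ i ∈ Finset.range (m + 1), max (-P.botMove i) 0 :=
      Finset.sum_nonneg fun i _ => le_max_right _ _
    have h3 := (Finset.sum_eq_zero_iff_of_nonneg fun i _ => le_max_right (-P.topMove i) 0).mp
      (show ∑ i ∈ Finset.range (m + 1), max (-P.topMove i) 0 = 0 by omega)
    have h4 := (Finset.sum_eq_zero_iff_of_nonneg fun i _ => le_max_right (-P.botMove i) 0).mp
      (show ∑ i ∈ Finset.range (m + 1), max (-P.botMove i) 0 = 0 by omega)
    refine ⟨fun i hi => ?_, fun i hi => ?_⟩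
    · have := h3 i (Finset.mem_range.mpr (by omega))
      omega
    · have := h4 i (Finset.mem_range.mpr (by omega))
      omega
  · rintro ⟨hT, hB⟩
    have hmin : P.yMin = 0 := yMin_eq_of_bounds
      (fun i hi => (ordinate_zero P.topMove).symm.le.trans
        (ordinate_le_of_nonneg (Nat.zero_le i) fun j _ hj => hT j (by omega)))
      (fun i hi => (ordinate_zero P.botMove).symm.le.trans
        (ordinate_le_of_nonneg (Nat.zero_le i) fun j _ hj => hB j (by omega)))
      (ordinate_zero P.topMove ▸ P.ordinate_top_mem (Nat.zero_le m))
    have hmax : P.yMax = ordinate P.topMove (m + 1) := yMax_eq_of_bounds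
      (fun i hi => ordinate_le_of_nonneg hi fun j _ hj => hT j (by omega))
      (fun i hi => hP.end_eq ▸ ordinate_le_of_nonneg hi fun j _ hj => hB j (by omega))
      (P.ordinate_top_succ_mem le_rfl)
    refine ⟨?_, ?_, ?_⟩
    · have h1 : ∑ i ∈ Finset.range (m + 1), |P.topMove i| = ordinate P.topMove (m + 1) :=
        Finset.sum_congr rfl fun i hi => abs_of_nonneg (hT i (by simpa [Nat.lt_succ_iff] using hi))
      have h2 : ∑ i ∈ Finset.range (m + 1), |P.botMove i| = ordinate P.botMove (m + 1) :=
        Finset.sum_congr rfl fun i hi => abs_of_nonneg (hB i (by simpa [Nat.lt_succ_iff] using hi))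
      rw [IsConvex, perimeter_eq, hmin, hmax, h1, h2, ← hP.end_eq]
      ring
    · rw [HasSW, hmin]
      exact ordinate_zero P.topMove ▸ P.ordinate_top_mem (Nat.zero_le m)
    · rw [HasNE, hmax]
      exact P.ordinate_top_succ_mem le_rfl

/-- The bottom path first has to reach the bottom of the rectangle at abscissa `m` and then makes
its last climb, which is split off; the excess counts descents of the top path and earlier rises of
the bottom path. -/
theorem stack_mem_iff (hm : 1 ≤ m) : PolygonClass.stack.Mem P ↔
    (∀ i ≤ m, 0 ≤ P.topMove i) ∧ ∀ i < m, P.botMove i ≤ 0 := by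
  have hP := P.isPolygonMoves hm
  have hlt := hP.ordinate_lt hm le_rfl
  have hlast : |P.botMove m| = ordinate P.topMove (m + 1) - ordinate P.botMove m := by
    rw [hP.bot_last, hP.top_end, abs_of_pos (by omega)]
  constructor
  · rintro ⟨hc, hse, hne⟩
    rw [IsConvex, perimeter_eq, yMax_of_hasNE hm hne, yMin_of_hasSE hm hse, sum_abs_eq,
      Finset.sum_range_succ (fun i => |P.botMove i|), sum_abs_eq', hlast] at hc
    have h1 : 0 ≤ ∑ i ∈ Finset.range (m + 1), max (-P.topMove i) 0 :=
      Finset.sum_nonneg fun i _ => le_max_right _ _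
    have h2 : 0 ≤ ∑ i ∈ Finset.range m, max (P.botMove i) 0 :=
      Finset.sum_nonneg fun i _ => le_max_right _ _
    have h3 := (Finset.sum_eq_zero_iff_of_nonneg fun i _ => le_max_right (-P.topMove i) 0).mp
      (show ∑ i ∈ Finset.range (m + 1), max (-P.topMove i) 0 = 0 by omega)
    have h4 := (Finset.sum_eq_zero_iff_of_nonneg fun i _ => le_max_right (P.botMove i) 0).mp
      (show ∑ i ∈ Finset.range m, max (P.botMove i) 0 = 0 by omega)
    refine ⟨fun i hi => ?_, fun i hi => ?_⟩
    · have := h3 i (Finset.mem_range.mpr (by omega))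
      omega
    · have := h4 i (Finset.mem_range.mpr (by omega))
      omega
  · rintro ⟨hT, hB⟩
    have hT0 : ∀ i ≤ m + 1, 0 ≤ ordinate P.topMove i := fun i hi =>
      (ordinate_zero P.topMove).symm.le.trans
        (ordinate_le_of_nonneg (Nat.zero_le i) fun j _ hj => hT j (by omega))
    have hB0 : ∀ i ≤ m, ordinate P.botMove i ≤ 0 := fun i hi =>
      (ordinate_le_of_nonpos (Nat.zero_le i) fun j _ hj => hB j (by omega)).trans
        (ordinate_zero P.botMove).le
    have hmin : P.yMin = ordinate P.botMove m := by
      refine yMin_eq_of_bounds (fun i hi => (hB0 m le_rfl).trans (hT0 i hi)) (fun i hi => ?_)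
        (P.ordinate_bot_mem le_rfl)
      rcases hi.lt_or_eq with hi | rfl
      · exact ordinate_le_of_nonpos (by omega) fun j _ hj => hB j hj
      · rw [← hP.end_eq]
        exact (hB0 m le_rfl).trans (hT0 _ le_rfl)
    have hmax : P.yMax = ordinate P.topMove (m + 1) := by
      refine yMax_eq_of_bounds
        (fun i hi => ordinate_le_of_nonneg hi fun j _ hj => hT j (by omega)) (fun i hi => ?_)
        (P.ordinate_top_succ_mem le_rfl)
      rcases hi.lt_or_eq with hi | rfl
      · exact (hB0 i (by omega)).trans (hT0 _ le_rfl)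
      · rw [← hP.end_eq]
    refine ⟨?_, ?_, ?_⟩
    · have h1 : ∑ i ∈ Finset.range (m + 1), |P.topMove i| = ordinate P.topMove (m + 1) :=
        Finset.sum_congr rfl fun i hi => abs_of_nonneg (hT i (by simpa [Nat.lt_succ_iff] using hi))
      have h2 : ∑ i ∈ Finset.range m, |P.botMove i| = -ordinate P.botMove m := by
        rw [ordinate, ← Finset.sum_neg_distrib]
        exact Finset.sum_congr rfl fun i hi => abs_of_nonpos (hB i (by simpa using hi))
      rw [IsConvex, perimeter_eq, hmin, hmax, Finset.sum_range_succ (fun i => |P.botMove i|), hlast,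
        h1, h2]
      ring
    · rw [HasSE, hmin]
      exact P.ordinate_bot_mem le_rfl
    · rw [HasNE, hmax]
      exact P.ordinate_top_succ_mem le_rfl

/-- Relative to stacks, the south-west corner says that the nonpositive bottom moves before the last
add up to 0, so all of them vanish. -/
theorem ferrers_mem_iff (hm : 1 ≤ m) : PolygonClass.ferrers.Mem P ↔
    (∀ i ≤ m, 0 ≤ P.topMove i) ∧ ∀ i < m, P.botMove i = 0 := by
  have hP := P.isPolygonMoves hm
  have hstack : PolygonClass.ferrers.Mem P ↔ PolygonClass.stack.Mem P ∧ P.HasSW := by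
    simp only [PolygonClass.Mem]
    tauto
  rw [hstack, stack_mem_iff hm]
  constructor
  · rintro ⟨⟨hT, hB⟩, hsw⟩
    have hse := ((stack_mem_iff hm).mpr ⟨hT, hB⟩).2.1
    have h0 : ordinate P.botMove m = 0 := by rw [← yMin_of_hasSE hm hse, yMin_of_hasSW hm hsw]
    refine ⟨hT, fun i hi => ?_⟩
    exact (Finset.sum_eq_zero_iff_of_nonpos fun i hi => hB i (Finset.mem_range.mp hi)).mp h0 i
      (Finset.mem_range.mpr hi)
  · rintro ⟨hT, hB⟩
    have hs : (∀ i ≤ m, 0 ≤ P.topMove i) ∧ ∀ i < m, P.botMove i ≤ 0 := ⟨hT, fun i hi => (hB i hi).le⟩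
    refine ⟨hs, ?_⟩
    have hse := ((stack_mem_iff hm).mpr hs).2.1
    have h0 : ordinate P.botMove m = 0 :=
      Finset.sum_eq_zero fun i hi => hB i (Finset.mem_range.mp hi)
    rw [HasSW, yMin_of_hasSE hm hse, h0]
    exact ordinate_zero P.topMove ▸ P.ordinate_top_mem (Nat.zero_le m)

/-- East steps of the top path lie strictly above those of the bottom path, so only the latter can
form the bottom edge. -/
theorem barGraph_mem_iff (hm : 1 ≤ m) : PolygonClass.barGraph.Mem P ↔
    ∀ i < m, P.botMove i = 0 := by
  have hP := P.isPolygonMoves hm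
  have hedge : ∀ i < m, (((i : ℤ), P.yMin), LatticeStep.E) ∈
      pathSteps (0, 0) P.top ++ pathSteps (0, 0) P.bot ↔ ordinate P.botMove (i + 1) = P.yMin := by
    intro i hi
    have h1 := yMin_le (P.ordinate_bot_succ_mem hi.le)
    have h2 := hP.ordinate_lt (i := i + 1) (by omega) (by omega)
    rw [P.top_eq, P.bot_eq, List.mem_append, east_mem_pathSteps_pathWord,
      east_mem_pathSteps_pathWord]
    simp only [zero_add, Prod.mk.injEq, Nat.cast_inj]
    constructor
    · rintro (⟨j, hj, rfl, h⟩ | ⟨j, hj, rfl, h⟩)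
      · simp only at h1
        omega
      · exact h.symm
    · intro h
      exact Or.inr ⟨i, hi, rfl, h.symm⟩
  have hbot : PolygonClass.barGraph.Mem P ↔ ∀ i < m, ordinate P.botMove (i + 1) = P.yMin := by
    constructor
    · intro h i hi
      exact (hedge i hi).mp (h i (by omega) (by exact_mod_cast hi))
    · intro h x hx hxm
      lift x to ℕ using hx
      have hx : x < m := by exact_mod_cast hxm
      exact (hedge x hx).mpr (h x hx)
  rw [hbot]
  constructor
  · intro h
    have h0 : P.yMin = 0 := by rw [← h 0 hm, ordinate_one, hP.bot_zero]
    intro i hi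
    rcases Nat.eq_zero_or_pos i with rfl | hpos
    · exact hP.bot_zero
    · have h1 := h i hi
      have h2 := h (i - 1) (by omega)
      rw [Nat.sub_add_cancel hpos, h0] at h2
      rw [ordinate_succ, h0, h2] at h1
      omega
  · intro h
    have hB : ∀ i ≤ m, ordinate P.botMove i = 0 := fun i hi =>
      Finset.sum_eq_zero fun j hj => h j (by have := Finset.mem_range.mp hj; omega)
    have hT : ∀ i ≤ m, 0 ≤ ordinate P.topMove i := fun i hi => by
      rcases Nat.eq_zero_or_pos i with rfl | hpos
      · exact (ordinate_zero _).symm.le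
      · have := hP.ordinate_lt hpos hi
        have := hB i hi
        omega
    have hend : 0 ≤ ordinate P.topMove (m + 1) := hP.top_end ▸ hT m le_rfl
    have hmin : P.yMin = 0 := by
      refine yMin_eq_of_bounds (x := 0) (fun i hi => ?_) (fun i hi => ?_)
        (ordinate_zero P.topMove ▸ P.ordinate_top_mem (Nat.zero_le m))
      · rcases hi.lt_or_eq with hi | rfl
        · exact hT i (by omega)
        · exact hend
      · rcases hi.lt_or_eq with hi | rfl
        · exact (hB i (by omega)).symm.le
        · exact hP.end_eq ▸ hend
    intro i hi
    rw [hmin, hB (i + 1) (by omega)]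

end ColumnConvexPolygon

/-- A polygon belongs to a class if and only if it has no forbidden steps. -/
theorem PolygonClass.mem_iff (c : PolygonClass) {m : ℕ} (hm : 1 ≤ m)
    (P : ColumnConvexPolygon m) : c.Mem P ↔ ∀ i ≤ m,
      (¬ c.Allowed m (.zt i) → stepsAt P.top .S i = 0) ∧
      (¬ c.Allowed m (.yb i) → stepsAt P.bot .N i = 0) ∧
      (¬ c.Allowed m (.zb i) → stepsAt P.bot .S i = 0) := by
  have hP := P.isPolygonMoves hm
  have hlast := hP.bot_last
  have hlt := hP.ordinate_lt hm le_rfl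
  have hsteps : ∀ i ≤ m, (stepsAt P.top .S i = 0 ↔ 0 ≤ P.topMove i) ∧
      (stepsAt P.bot .N i = 0 ↔ P.botMove i ≤ 0) ∧ (stepsAt P.bot .S i = 0 ↔ 0 ≤ P.botMove i) := by
    intro i hi
    rw [(P.stepsAt_top hi).2, (P.stepsAt_bot hi).1, (P.stepsAt_bot hi).2]
    omega
  have hiff : (∀ i ≤ m, (¬ c.Allowed m (.zt i) → stepsAt P.top .S i = 0) ∧
      (¬ c.Allowed m (.yb i) → stepsAt P.bot .N i = 0) ∧
      (¬ c.Allowed m (.zb i) → stepsAt P.bot .S i = 0)) ↔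
      ∀ i ≤ m, (¬ c.Allowed m (.zt i) → 0 ≤ P.topMove i) ∧
      (¬ c.Allowed m (.yb i) → P.botMove i ≤ 0) ∧ (¬ c.Allowed m (.zb i) → 0 ≤ P.botMove i) := by
    refine forall₂_congr fun i hi => ?_
    rw [(hsteps i hi).1, (hsteps i hi).2.1, (hsteps i hi).2.2]
  rw [hiff]
  cases c
  case ferrers =>
    rw [ColumnConvexPolygon.ferrers_mem_iff hm]
    simp only [Allowed, reduceCtorEq, or_false, not_false_eq_true, true_imp_iff]
    constructor
    · rintro ⟨hT, hB⟩ i hi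
      refine ⟨hT i hi, fun hne => (hB i (by omega)).le, ?_⟩
      -- At the last abscissa the bottom move is the height of the last column, hence positive.
      rcases hi.lt_or_eq with h | rfl
      · exact (hB i h).symm.le
      · omega
    · intro h
      exact ⟨fun i hi => (h i hi).1, fun i hi =>
        le_antisymm ((h i hi.le).2.1 hi.ne) (h i hi.le).2.2⟩
  case stack =>
    rw [ColumnConvexPolygon.stack_mem_iff hm]
    simp only [Allowed, reduceCtorEq, or_false, not_false_eq_true, true_imp_iff, not_true_eq_false,
      false_imp_iff, and_true]
    constructor
    · rintro ⟨hT, hB⟩ i hi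
      exact ⟨hT i hi, fun hne => hB i (by omega)⟩
    · intro h
      exact ⟨fun i hi => (h i hi).1, fun i hi => (h i hi.le).2 hi.ne⟩
  case staircase =>
    rw [ColumnConvexPolygon.staircase_mem_iff hm]
    simp only [Allowed, reduceCtorEq, or_false, or_true, not_false_eq_true, true_imp_iff,
      not_true_eq_false, false_imp_iff, true_and]
    exact ⟨fun h i hi => ⟨h.1 i hi, h.2 i hi⟩, fun h => ⟨fun i hi => (h i hi).1,
      fun i hi => (h i hi).2⟩⟩
  case barGraph =>
    rw [ColumnConvexPolygon.barGraph_mem_iff hm]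
    simp only [Allowed, reduceCtorEq, or_false, not_false_eq_true, true_imp_iff,
      not_true_eq_false, false_imp_iff, true_and]
    constructor
    · intro hB i hi
      refine ⟨fun hne => (hB i (by omega)).le, ?_⟩
      rcases hi.lt_or_eq with h | rfl
      · exact (hB i h).symm.le
      · omega
    · intro h i hi
      exact le_antisymm ((h i hi.le).1 hi.ne) (h i hi.le).2
  case columnConvex =>
    simp [Allowed, Mem]

/-! ### The generating function as a sum over codes -/

noncomputable section

namespace PolygonClass

open Classical in
-- A polygon outside the class makes a forbidden step, whose letter 0 annihilates the product;
-- inside the class only genuine variables occur with positive exponent.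
theorem prod_letter (c : PolygonClass) {m : ℕ} (hm : 1 ≤ m) (P : ColumnConvexPolygon m) :
    ∏ i ∈ Finset.range (m + 1),
      (c.letter m (.yt i) ^ stepsAt P.top .N i * c.letter m (.zt i) ^ stepsAt P.top .S i *
        c.letter m (.yb i) ^ stepsAt P.bot .N i * c.letter m (.zb i) ^ stepsAt P.bot .S i) =
      if c.Mem P then MvPowerSeries.monomial P.weight 1 else 0 := by
  have hpow : ∀ v k, (¬ c.Allowed m v → k = 0) → c.letter m v ^ k = MvPowerSeries.X v ^ k := by
    intro v k h
    by_cases hv : c.Allowed m v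
    · rw [letter, if_pos hv]
    · rw [h hv, pow_zero, pow_zero]
  have hzero : ∀ v k, ¬ c.Allowed m v → k ≠ 0 → c.letter m v ^ k = 0 := by
    intro v k hv hk
    rw [letter, if_neg hv, zero_pow hk]
  have hsingle : ∀ v k, (Finsupp.single v k).prod (fun v k =>
      (MvPowerSeries.X v : MvPowerSeries StepVar ℝ) ^ k) = MvPowerSeries.X v ^ k := fun v k =>
    Finsupp.prod_single_index (pow_zero _)
  split_ifs with h
  · rw [MvPowerSeries.monomial_one_eq, ColumnConvexPolygon.weight,
      ← Finsupp.prod_finsetSum_index (fun _ => pow_zero _) (fun _ _ _ => pow_add _ _ _)]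
    refine Finset.prod_congr rfl fun i hi => ?_
    have hi' : i ≤ m := by
      have := Finset.mem_range.mp hi
      omega
    obtain ⟨h1, h2, h3⟩ := (c.mem_iff hm P).mp h i hi'
    rw [hpow _ _ h1, hpow _ _ h2, hpow _ _ h3, hpow (.yt i) _ fun h => (h trivial).elim]
    rw [Finsupp.prod_add_index' (fun _ => pow_zero _) (fun _ _ _ => pow_add _ _ _),
      Finsupp.prod_add_index' (fun _ => pow_zero _) (fun _ _ _ => pow_add _ _ _),
      Finsupp.prod_add_index' (fun _ => pow_zero _) (fun _ _ _ => pow_add _ _ _),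
      hsingle, hsingle, hsingle, hsingle]
  · rw [c.mem_iff hm P] at h
    push Not at h
    obtain ⟨i, hi, h⟩ := h
    refine Finset.prod_eq_zero (Finset.mem_range.mpr (Nat.lt_succ_of_le hi)) ?_
    by_cases h1 : ¬ c.Allowed m (.zt i) ∧ stepsAt P.top .S i ≠ 0
    · rw [hzero _ _ h1.1 h1.2]
      ring
    by_cases h2 : ¬ c.Allowed m (.yb i) ∧ stepsAt P.bot .N i ≠ 0
    · rw [hzero _ _ h2.1 h2.2]
      ring
    · obtain ⟨h3, h4⟩ := h (fun h => by_contra fun h' => h1 ⟨h, h'⟩)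
        fun h => by_contra fun h' => h2 ⟨h, h'⟩
      rw [hzero _ _ h3 h4]
      ring

open Classical in
-- Codes that come from no polygon have weight 0, so the sum over codes restricts to polygons, each
-- contributing a single monomial or 0.
theorem hasSum_coeff (c : PolygonClass) (n : ℕ) (e : StepVar →₀ ℕ) :
    HasSum (fun P : ColumnConvexPolygon (n + 1) => if P ∈ c.withWeight (n + 1) e then (1 : ℝ) else 0)
      (MvPowerSeries.coeff e (∑' a, codeWeight (c.letter (n + 1)) n a)) := by
  have h := (summable_codeWeight (constantCoeff_letter (c := c) (m := n + 1)) n).hasSum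
  rw [← (ColumnConvexPolygon.code_injective n).hasSum_iff fun a ha =>
    codeWeight_eq_zero_of_notMem_range _ ha] at h
  refine (hasSum_iff_of_eq fun P => ?_).mp
    (MvPowerSeries.WithPiTopology.hasSum_iff_hasSum_coeff.mp h e)
  rw [Function.comp_apply, codeWeight_code, prod_letter c (by omega)]
  by_cases hP : c.Mem P
  · rw [if_pos hP, MvPowerSeries.coeff_monomial]
    exact if_congr ⟨fun h => ⟨hP, h.symm⟩, fun h => h.2.symm⟩ rfl rfl
  · rw [if_neg hP, if_neg fun h => hP h.1, map_zero]

/-- The terms of a summable real family tend to 0 along the cofinite filter, so an indicator can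
take the value 1 only finitely often. -/
theorem finite_withWeight (c : PolygonClass) (n : ℕ) (e : StepVar →₀ ℕ) :
    (c.withWeight (n + 1) e).Finite := by
  classical
  have h := (c.hasSum_coeff n e).summable.tendsto_cofinite_zero
  have h1 := h.eventually (gt_mem_nhds (show (0 : ℝ) < 1 by norm_num))
  rw [Filter.eventually_cofinite] at h1
  refine h1.subset fun P hP => ?_
  simp only [Set.mem_ofPred_eq, if_pos hP, lt_irrefl, not_false_eq_true]

theorem genFun_eq_tsum (c : PolygonClass) (n : ℕ) :
    c.genFun (n + 1) = ∑' a, codeWeight (c.letter (n + 1)) n a := by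
  classical
  ext e
  refine HasSum.unique ?_ (c.hasSum_coeff n e)
  have hfin := c.finite_withWeight n e
  have h := hasSum_sum_of_ne_finset_zero (L := .unconditional _) (s := hfin.toFinset)
    (f := fun P => if P ∈ c.withWeight (n + 1) e then (1 : ℝ) else 0)
    fun P hP => if_neg fun h => hP (hfin.mem_toFinset.mpr h)
  rw [Finset.sum_congr rfl fun P hP => if_pos (hfin.mem_toFinset.mp hP), Finset.sum_const,
    nsmul_eq_mul, mul_one, ← Set.ncard_eq_toFinset_card _ hfin] at h
  exact h

end PolygonClass

end

/-! ### The reciprocity theorem -/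

theorem theorem1 (c : PolygonClass) (m : ℕ) (hm : 1 ≤ m) :
    (∀ e : StepVar →₀ ℕ, (c.withWeight m e).Finite) ∧
    ∃ f : RationalFun StepVar,
      RationalFun.IsExpansion (c.genFun m) f ∧
      RationalFun.IsSelfReciprocal f ∧
      ((c = PolygonClass.staircase → 2 ≤ m) →
        RationalFun.recip f = c.factor m * f) := by
  obtain ⟨n, rfl⟩ : ∃ n, m = n + 1 := ⟨m - 1, by omega⟩
  obtain ⟨f, hf, hs, hr⟩ := c.exists_reciprocal n
  exact ⟨c.finite_withWeight n, f,
    RationalFun.isExpansion_of_expand_eq (by rw [c.genFun_eq_tsum, hf]), hs, hr⟩
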